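/- Let $\mathbb A$ be a countably infinite set of atoms, let $A$ be an orbit-finite nominal alphabet, and let $\mathcal L\subseteq A^*$ be a nominal regular language, i.e. a language recognized by a nominal DFA (orbit-finite nominal set of states, equivariant structure). Residuals and primes. A residual of $\mathcal L$ is a language $u^{-1}\mathcal L=\{v : uv\in\mathcal L\}$ with $u\in A^*$; it is prime if it is not the union of the residuals of $\mathcal L$ that it strictly contains. The canonical nominal RFSA of $\mathcal L$ is the nominal NFA whose states are the prime residuals of $\mathcal L$, whose initial states are the prime residuals $K\subseteq\mathcal L$, whose final states are those with $\varepsilon\in K$, and with $\delta(K,a)=\{K' \text{ prime} : K'\subseteq a^{-1}K\}$. Tables. An observation table is a pair $(S,E)$ of equivariant subsets of $A^*$. For $u\in S\cup SA$ let $row(u)\in 2^E$, $row(u)(e)=1$ iff $ue\in\mathcal L$; rows are ordered pointwise ($\sqsubseteq$, strictly $\sqsubset$) and $\bigsqcup$ is the pointwise union. A row $r$ is prime if it is not the union of all rows $r'\sqsubset r$ of the table; $PR(S,E)$ is the set of prime rows and $PR^\top(S,E)$ the set of those of the form $row(s)$ with $s\in S$. The table is RFSA-closed if $row(t)=\bigsqcup\{r\in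 PR^\top(S,E): r\sqsubseteq row(t)\}$ for all $t\in SA$, and RFSA-consistent if for all $s_1,s_2\in S$, $a\in A$, $row(s_1)\sqsubseteq row(s_2)$ implies $row(s_1a)\sqsubseteq row(s_2a)$. The conjecture $N(S,E)$ has states $PR^\top(S,E)$, initial states those $r\sqsubseteq row(\varepsilon)$, final states those with $r(\varepsilon)=1$, and $\delta(row(s),a)=\{r\in PR^\top(S,E): r\sqsubseteq row(sa)\}$ for $s\in S$. The algorithm $\nu\mathrm{NL}^\star$. Start with $S=E=\{\varepsilon\}$ and repeat the following. (1) While $(S,E)$ is not RFSA-closed or not RFSA-consistent: first, if it is not RFSA-closed, pick $s\in S$, $a\in A$ with $row(sa)\in PR(S,E)\setminus PR^\top(S,E)$ and replace $S$ by $S\cup\mathrm{orb}(sa)$; then, if the table is not RFSA-consistent, pick $s_1,s_2\in S$, $a\in A$, $e\in E$ with $row(s_1)\sqsubseteq row(s_2)$, $s_1ae\in\mathcal L$, $s_2ae\notin\mathcal L$ and replace $E$ by $E\cup\mathrm{orb}(ae)$. (2) Conjecture $N(S,E)$. If $N(S,E)$ accepts exactly $\mathcal L$, the teacher says yes and the algorithm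 returns $N(S,E)$; otherwise the teacher gives a word $t$ in the symmetric difference of $\mathcal L$ and the language of $N(S,E)$, and $E$ is replaced by $E\cup\mathrm{suffixes}(\mathrm{orb}(t))$. The operations on orbit-finite sets in each line count as single steps. **Theorem.** For every choice of witnesses and of counterexamples, $\nu\mathrm{NL}^\star$ with target $\mathcal L$ terminates and returns the canonical nominal RFSA of $\mathcal L$. In detail: there is no infinite run; a run that has not returned can always take a further step; every table $(S,E)$ that occurs consists of orbit-finite nominal sets, and $N(S,E)$ is a nominal NFA; and whenever an automaton $N(S,E)$ is returned, it is a nominal RFSA, it accepts $\mathcal L$, and it is isomorphic, as a nominal NFA, to the canonical nominal RFSA of $\mathcal L$. -/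

import Mathlib

universe u v w

namespace NominalLearning

/-- Letterwise action of a group on words over an alphabet. -/
instance wordAction {G : Type u} {A : Type v} [Group G] [MulAction G A] :
    MulAction G (List A) where
  smul g x := x.map (fun a => g • a)
  one_smul x := by
    change x.map (fun a => (1 : G) • a) = x
    simp
  mul_smul g h x := by
    change x.map (fun a => (g * h) • a) = (x.map (fun a => h • a)).map (fun a => g • a)
    simp [mul_smul]

/-- Elementwise action of a group on sets of words: `w ∈ g • K` iff `g⁻¹ • w ∈ K`. -/
instance languageAction {G : Type u} {A : Type v} [Group G] [MulAction G A] :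
    MulAction G (Language A) where
  smul g K := {x : List A | g⁻¹ • x ∈ K}
  one_smul K := by
    apply Set.ext
    intro x
    change (1 : G)⁻¹ • x ∈ K ↔ x ∈ K
    simp
  mul_smul g h K := by
    apply Set.ext
    intro x
    change (g * h)⁻¹ • x ∈ K ↔ h⁻¹ • g⁻¹ • x ∈ K
    rw [mul_inv_rev, mul_smul]

section Actions

variable {G : Type u} {A : Type v} [Group G] [MulAction G A]

theorem smul_nil (g : G) : g • ([] : List A) = [] := rfl

theorem smul_cons (g : G) (a : A) (x : List A) : g • (a :: x) = g • a :: g • x := rfl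

theorem smul_append (g : G) (x y : List A) : g • (x ++ y) = g • x ++ g • y :=
  List.map_append

theorem mem_smul_language (g : G) (K : Language A) (x : List A) :
    x ∈ g • K ↔ g⁻¹ • x ∈ K := Iff.rfl

theorem smul_language_le_iff (g : G) (K K' : Language A) : g • K ≤ g • K' ↔ K ≤ K' := by
  constructor
  · intro h x hx
    have h1 : g⁻¹ • g • x ∈ K' :=
      @h (g • x) (show g⁻¹ • g • x ∈ K by rw [inv_smul_smul]; exact hx)
    rw [inv_smul_smul] at h1
    exact h1
  · intro h x hx
    exact @h (g⁻¹ • x) hx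

theorem smul_language_lt_iff (g : G) (K K' : Language A) : g • K < g • K' ↔ K < K' := by
  rw [lt_iff_le_not_ge, lt_iff_le_not_ge, smul_language_le_iff, smul_language_le_iff]

end Actions

/-! ### Nominal sets and nominal automata -/

/-- `X`, with its action of the permutations of the atoms `𝔸`, is an orbit-finite nominal set:
every element is supported by a finite set of atoms, and there are finitely many orbits. -/
def OrbitFiniteNominal (𝔸 : Type u) (X : Type v) [MulAction (Equiv.Perm 𝔸) X] : Prop :=
  (∀ x : X, ∃ s : Finset 𝔸, MulAction.Supports (Equiv.Perm 𝔸) (s : Set 𝔸) x) ∧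
    Finite (MulAction.orbitRel.Quotient (Equiv.Perm 𝔸) X)

/-- Nominal NFA: the states and the alphabet are orbit-finite nominal sets, and the initial
states, the final states and the transition relation are equivariant. -/
structure IsNominalNFA (𝔸 : Type u) {A : Type v} {Q : Type w} [MulAction (Equiv.Perm 𝔸) A]
    [MulAction (Equiv.Perm 𝔸) Q] (M : NFA A Q) : Prop where
  states : OrbitFiniteNominal 𝔸 Q
  alphabet : OrbitFiniteNominal 𝔸 A
  start : ∀ (π : Equiv.Perm 𝔸) (q : Q), q ∈ M.start → π • q ∈ M.start
  accept : ∀ (π : Equiv.Perm 𝔸) (q : Q), q ∈ M.accept → π • q ∈ M.accept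
  step : ∀ (π : Equiv.Perm 𝔸) (q : Q) (a : A) (q' : Q),
    q' ∈ M.step q a → π • q' ∈ M.step (π • q) (π • a)

/-- `L` is nominal regular: some nominal DFA recognizes it. A nominal DFA is a nominal NFA with
exactly one initial state whose transition relation is a function. -/
def IsNominalRegular (𝔸 : Type u) {A : Type v} [MulAction (Equiv.Perm 𝔸) A]
    (L : Language A) : Prop :=
  ∃ (Q : Type w) (_ : MulAction (Equiv.Perm 𝔸) Q) (M : DFA A Q),
    IsNominalNFA 𝔸 M.toNFA ∧ M.accepts = L

/-- `L` is equivariant. -/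
def IsEquivariant (𝔸 : Type u) {A : Type v} [MulAction (Equiv.Perm 𝔸) A]
    (L : Language A) : Prop :=
  ∀ (π : Equiv.Perm 𝔸) (x : List A), x ∈ L → π • x ∈ L

theorem IsNominalRegular.isEquivariant {𝔸 : Type u} {A : Type v} [MulAction (Equiv.Perm 𝔸) A]
    {L : Language A} (h : IsNominalRegular.{u, v, w} 𝔸 L) : IsEquivariant 𝔸 L := by
  obtain ⟨Q, _, M, hM, rfl⟩ := h
  have key : ∀ (π : Equiv.Perm 𝔸) (x : List A) (q : Q),
      M.evalFrom (π • q) (π • x) = π • M.evalFrom q x := by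
    intro π x
    induction x with
    | nil => intro q; rfl
    | cons a x ih =>
      intro q
      have hs : π • M.step q a = M.step (π • q) (π • a) := by
        simpa [DFA.toNFA] using hM.step π q a (M.step q a) (by simp [DFA.toNFA])
      rw [smul_cons, DFA.evalFrom_cons, DFA.evalFrom_cons, ← hs, ih]
  intro π x hx
  have h0 : π • M.start = M.start := by
    simpa [DFA.toNFA] using hM.start π M.start (by simp [DFA.toNFA])
  rw [DFA.mem_accepts] at hx ⊢
  have := hM.accept π _ hx
  unfold DFA.eval
  rw [← h0, key]
  exact this

/-- The set of residuals `u⁻¹L` of `L`. -/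
def residuals {A : Type v} (L : Language A) : Set (Language A) :=
  Set.range L.leftQuotient

/-- Nominal residual automaton: a nominal NFA each of whose states recognizes a residual of the
language of the automaton. -/
def IsNominalRFSA (𝔸 : Type u) {A : Type v} {Q : Type w} [MulAction (Equiv.Perm 𝔸) A]
    [MulAction (Equiv.Perm 𝔸) Q] (M : NFA A Q) : Prop :=
  IsNominalNFA 𝔸 M ∧ ∀ q : Q, M.acceptsFrom {q} ∈ residuals M.accepts

/-- Isomorphism of nominal NFAs: an equivariant bijection on states that preserves and reflects
initial states, final states and transitions. -/
structure NominalNFAIso (𝔸 : Type u) {A : Type v} {Q Q' : Type w} [MulAction (Equiv.Perm 𝔸) A]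
    [MulAction (Equiv.Perm 𝔸) Q] [MulAction (Equiv.Perm 𝔸) Q']
    (M : NFA A Q) (M' : NFA A Q') extends Q ≃ Q' where
  map_smul : ∀ (π : Equiv.Perm 𝔸) (q : Q), toFun (π • q) = π • toFun q
  start_iff : ∀ q : Q, toFun q ∈ M'.start ↔ q ∈ M.start
  accept_iff : ∀ q : Q, toFun q ∈ M'.accept ↔ q ∈ M.accept
  step_iff : ∀ (q : Q) (a : A) (q' : Q), toFun q' ∈ M'.step (toFun q) a ↔ q' ∈ M.step q a

/-! ### Primes and the canonical nominal RFSA -/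

/-- `r` is a prime element of the family `R`: it is not the union of the members of `R` that it
strictly contains. -/
def IsPrimeIn {A : Type v} (R : Set (Language A)) (r : Language A) : Prop :=
  r ∈ R ∧ r ≠ sSup {r' | r' ∈ R ∧ r' < r}

theorem IsPrimeIn.smul {G : Type u} {A : Type v} [Group G] [MulAction G A]
    {R : Set (Language A)} (hR : ∀ (g : G) (r : Language A), r ∈ R → g • r ∈ R) (g : G)
    {r : Language A} (h : IsPrimeIn R r) : IsPrimeIn R (g • r) := by
  refine ⟨hR g r h.1, fun he => h.2 (le_antisymm ?_ (sSup_le fun r' hr' => hr'.2.le))⟩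
  rw [← smul_language_le_iff g]
  refine he.le.trans (sSup_le ?_)
  rintro r' ⟨h1, h2⟩
  have h3 : g⁻¹ • r' < r := by
    rw [← smul_language_lt_iff g, smul_inv_smul]
    exact h2
  have h4 : g⁻¹ • r' ≤ sSup {r' | r' ∈ R ∧ r' < r} := le_sSup ⟨hR _ _ h1, h3⟩
  rw [← smul_language_le_iff g, smul_inv_smul] at h4
  exact h4

section Target

variable {𝔸 : Type u} {A : Type v} [MulAction (Equiv.Perm 𝔸) A]

theorem IsEquivariant.smul_mem_iff {L : Language A} (hL : IsEquivariant 𝔸 L) (π : Equiv.Perm 𝔸)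
    (x : List A) : π • x ∈ L ↔ x ∈ L :=
  ⟨fun h => by simpa using hL π⁻¹ _ h, hL π x⟩

/-- The equivariant set of prime residuals of `L`. -/
def primeResiduals (L : Language A) (hL : IsEquivariant 𝔸 L) :
    SubMulAction (Equiv.Perm 𝔸) (Language A) where
  carrier := {K | IsPrimeIn (residuals L) K}
  smul_mem' := by
    intro π K hK
    refine IsPrimeIn.smul ?_ π hK
    rintro π _ ⟨x, rfl⟩
    refine ⟨π • x, ?_⟩
    apply Set.ext
    intro y
    change π • x ++ y ∈ L ↔ x ++ π⁻¹ • y ∈ L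
    rw [← hL.smul_mem_iff π (x ++ π⁻¹ • y), smul_append, smul_inv_smul]

/-- The canonical nominal RFSA of `L`. -/
def canonicalRFSA (L : Language A) (hL : IsEquivariant 𝔸 L) : NFA A (primeResiduals L hL) where
  step K a := {K' | (K' : Language A) ≤ (K : Language A).leftQuotient [a]}
  start := {K | (K : Language A) ≤ L}
  accept := {K | [] ∈ (K : Language A)}

/-! ### Observation tables -/

/-- Observation table `(S, E)`: equivariant sets of words `S` (rows) and `E` (columns). -/
structure ObsTable (𝔸 : Type u) (A : Type v) [MulAction (Equiv.Perm 𝔸) A] where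
  S : SubMulAction (Equiv.Perm 𝔸) (List A)
  E : SubMulAction (Equiv.Perm 𝔸) (List A)

namespace ObsTable

/-- The set `S·A`. -/
def lower (T : ObsTable 𝔸 A) : Set (List A) :=
  {t | ∃ s ∈ T.S, ∃ a : A, t = s ++ [a]}

/-- `row(u) ∈ 2^E`, identified with the subset `{e ∈ E | u e ∈ L}` of `E`. The union of rows is
then `⊔`, and row containment is `≤`. -/
def row (L : Language A) (T : ObsTable 𝔸 A) (x : List A) : Language A :=
  {e : List A | e ∈ T.E ∧ x ++ e ∈ L}

/-- All rows of the table, indexed by `S ∪ S·A`. -/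
def rows (L : Language A) (T : ObsTable 𝔸 A) : Set (Language A) :=
  {r | ∃ x : List A, (x ∈ T.S ∨ x ∈ T.lower) ∧ r = T.row L x}

theorem smul_row {L : Language A} (hL : IsEquivariant 𝔸 L) (T : ObsTable 𝔸 A)
    (π : Equiv.Perm 𝔸) (x : List A) : π • T.row L x = T.row L (π • x) := by
  apply Set.ext
  intro e
  change (π⁻¹ • e ∈ T.E ∧ x ++ π⁻¹ • e ∈ L) ↔ (e ∈ T.E ∧ π • x ++ e ∈ L)
  have he : π⁻¹ • e ∈ T.E ↔ e ∈ T.E :=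
    ⟨fun h => by simpa using T.E.smul_mem π h, T.E.smul_mem π⁻¹⟩
  rw [← hL.smul_mem_iff π (x ++ π⁻¹ • e), smul_append, smul_inv_smul, he]

/-- The prime rows of the whole table, `PR(S,E)`. -/
def primeRows (L : Language A) (T : ObsTable 𝔸 A) : Set (Language A) :=
  {r | IsPrimeIn (T.rows L) r}

/-- `PR^⊤(S,E)`: the rows of the top part (indexed by `S`) that are prime with respect to the
whole table; an equivariant set. -/
def topPrimeRows (L : Language A) (hL : IsEquivariant 𝔸 L) (T : ObsTable 𝔸 A) :
    SubMulAction (Equiv.Perm 𝔸) (Language A) where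
  carrier := {r | r ∈ T.primeRows L ∧ ∃ s ∈ T.S, r = T.row L s}
  smul_mem' := by
    rintro π r ⟨h, s, hs, rfl⟩
    refine ⟨IsPrimeIn.smul ?_ π h, π • s, T.S.smul_mem π hs, smul_row hL T π s⟩
    rintro π _ ⟨x, hx | ⟨s, hs, a, rfl⟩, rfl⟩
    · exact ⟨π • x, Or.inl (T.S.smul_mem π hx), smul_row hL T π x⟩
    · exact ⟨π • (s ++ [a]), Or.inr ⟨π • s, T.S.smul_mem π hs, π • a, smul_append π s [a]⟩,
        smul_row hL T π _⟩

def RFSAClosed (L : Language A) (hL : IsEquivariant 𝔸 L) (T : ObsTable 𝔸 A) : Prop :=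
  ∀ t ∈ T.lower, T.row L t = sSup {r | r ∈ T.topPrimeRows L hL ∧ r ≤ T.row L t}

def RFSAConsistent (L : Language A) (T : ObsTable 𝔸 A) : Prop :=
  ∀ s₁ ∈ T.S, ∀ s₂ ∈ T.S, ∀ a : A,
    T.row L s₁ ≤ T.row L s₂ → T.row L (s₁ ++ [a]) ≤ T.row L (s₂ ++ [a])

/-- The conjecture automaton `N(S,E)`: its transitions are
`δ(row(s), a) = {r ∈ PR^⊤(S,E) | r ⊑ row(sa)}` for `s ∈ S` (for an RFSA-consistent table this
does not depend on the choice of `s`). -/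
def conjectureNFA (L : Language A) (hL : IsEquivariant 𝔸 L) (T : ObsTable 𝔸 A) :
    NFA A (T.topPrimeRows L hL) where
  step q a := {r | ∃ s ∈ T.S, (q : Language A) = T.row L s ∧
    (r : Language A) ≤ T.row L (s ++ [a])}
  start := {r | (r : Language A) ≤ T.row L []}
  accept := {r | [] ∈ (r : Language A)}

end ObsTable

/-! ### The learner -/

/-- `{ε}` as an equivariant set of words. -/
def emptyWord (𝔸 : Type u) (A : Type v) [MulAction (Equiv.Perm 𝔸) A] :
    SubMulAction (Equiv.Perm 𝔸) (List A) where
  carrier := {[]}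
  smul_mem' := by
    rintro π x rfl
    exact smul_nil π

/-- The orbit of a word. -/
def wordOrbit (𝔸 : Type u) {A : Type v} [MulAction (Equiv.Perm 𝔸) A] (x : List A) :
    SubMulAction (Equiv.Perm 𝔸) (List A) where
  carrier := MulAction.orbit (Equiv.Perm 𝔸) x
  smul_mem' := by
    rintro π _ ⟨σ, rfl⟩
    exact ⟨π * σ, mul_smul π σ x⟩

/-- All suffixes of all words in the orbit of `t`. -/
def orbitSuffixes (𝔸 : Type u) {A : Type v} [MulAction (Equiv.Perm 𝔸) A] (t : List A) :
    SubMulAction (Equiv.Perm 𝔸) (List A) where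
  carrier := {y | ∃ x ∈ wordOrbit 𝔸 t, y <:+ x}
  smul_mem' := by
    rintro π y ⟨x, hx, z, rfl⟩
    exact ⟨π • (z ++ y), (wordOrbit 𝔸 t).smul_mem π hx, π • z, (smul_append π z y).symm⟩

/-- Control points of the learner, each with the current table:
`whileTest`: the test of the while loop (is the table RFSA-closed and RFSA-consistent?);
`closedTest`, `consistentTest`: the first and the second conditional in the loop body;
`conjecture`: `N(S,E)` is conjectured and the teacher is asked an equivalence query;
`returned`: the learner has halted and returned `N(S,E)`. -/
inductive Config (𝔸 : Type u) (A : Type v) [MulAction (Equiv.Perm 𝔸) A] where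
  | whileTest (T : ObsTable 𝔸 A)
  | closedTest (T : ObsTable 𝔸 A)
  | consistentTest (T : ObsTable 𝔸 A)
  | conjecture (T : ObsTable 𝔸 A)
  | returned (T : ObsTable 𝔸 A)

/-- The table of a configuration. -/
def Config.table : Config 𝔸 A → ObsTable 𝔸 A
  | .whileTest T => T
  | .closedTest T => T
  | .consistentTest T => T
  | .conjecture T => T
  | .returned T => T

/-- The start of the learner: `S, E ← {ε}`. -/
def Config.init (𝔸 : Type u) (A : Type v) [MulAction (Equiv.Perm 𝔸) A] : Config 𝔸 A :=
  .whileTest ⟨emptyWord 𝔸 A, emptyWord 𝔸 A⟩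

/-- One step of the learner with target language `L`. The relation is nondeterministic: the
learner may pick any witness, and the teacher may answer with any counterexample. -/
inductive Step (L : Language A) (hL : IsEquivariant 𝔸 L) : Config 𝔸 A → Config 𝔸 A → Prop
  | enterLoop (T : ObsTable 𝔸 A) (h : ¬ (T.RFSAClosed L hL ∧ T.RFSAConsistent L)) :
      Step L hL (.whileTest T) (.closedTest T)
  | exitLoop (T : ObsTable 𝔸 A) (h : T.RFSAClosed L hL ∧ T.RFSAConsistent L) :
      Step L hL (.whileTest T) (.conjecture T)
  | skipClosed (T : ObsTable 𝔸 A) (h : T.RFSAClosed L hL) :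
      Step L hL (.closedTest T) (.consistentTest T)
  | addRow (T : ObsTable 𝔸 A) (h : ¬ T.RFSAClosed L hL) (s : List A) (a : A) (hs : s ∈ T.S)
      (hp : T.row L (s ++ [a]) ∈ T.primeRows L)
      (hn : T.row L (s ++ [a]) ∉ T.topPrimeRows L hL) :
      Step L hL (.closedTest T) (.consistentTest ⟨T.S ⊔ wordOrbit 𝔸 (s ++ [a]), T.E⟩)
  | skipConsistent (T : ObsTable 𝔸 A) (h : T.RFSAConsistent L) :
      Step L hL (.consistentTest T) (.whileTest T)
  | addColumn (T : ObsTable 𝔸 A) (h : ¬ T.RFSAConsistent L) (s₁ s₂ : List A) (a : A)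
      (e : List A) (hs₁ : s₁ ∈ T.S) (hs₂ : s₂ ∈ T.S) (he : e ∈ T.E)
      (hle : T.row L s₁ ≤ T.row L s₂) (h₁ : s₁ ++ a :: e ∈ L) (h₂ : s₂ ++ a :: e ∉ L) :
      Step L hL (.consistentTest T) (.whileTest ⟨T.S, T.E ⊔ wordOrbit 𝔸 (a :: e)⟩)
  | counterexample (T : ObsTable 𝔸 A) (t : List A)
      (ht : ¬ (t ∈ (T.conjectureNFA L hL).accepts ↔ t ∈ L)) :
      Step L hL (.conjecture T) (.whileTest ⟨T.S, T.E ⊔ orbitSuffixes 𝔸 t⟩)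
  | accepted (T : ObsTable 𝔸 A) (h : (T.conjectureNFA L hL).accepts = L) :
      Step L hL (.conjecture T) (.returned T)

/-- `c` occurs in some run of the learner. -/
def Reachable (L : Language A) (hL : IsEquivariant 𝔸 L) (c : Config 𝔸 A) : Prop :=
  Relation.ReflTransGen (Step L hL) (Config.init 𝔸 A) c

end Target

end NominalLearning

/-! Everything is governed by the residuals of `L`. A nominal DFA bounds them by finitely many
orbits, and every row is the restriction of a residual to the columns. Orbit-finiteness alone would
not exclude an infinite descending chain of rows; finite support does. If `π • x < x`, then `π` may
be replaced by a permutation of finite order that agrees with it on a support of `x`, and iterating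
gives `x < x` (`FinitelySupported.not_smul_lt`). So strict inclusion is well-founded on rows, and
every row is the union of the prime rows below it (`row_eq_sSup_primeRows`).

Termination rests on a lexicographic measure. A new row adds an orbit of residuals of words of `S`.
A new column deletes an orbit of pairs from the preorder that `E` induces on residuals; this
preorder is orbit-finite by `OrbitFiniteSet.prod`. If a counterexample leaves the preorder
unchanged, prime rows stay prime and some further residual gets a prime row: otherwise the states of
the refuted conjecture would classify every new column correctly, the counterexample included
(`mem_acceptsFrom_conjectureNFA_iff`).

For the result, let the table be closed and consistent, with `S` prefix-closed and `E`
suffix-closed. The language of a state, cut down to `E`, is its row, and inclusion of languages is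
inclusion of rows. If the conjecture accepts `L`, primality forces `s` to reach the state `row(s)`,
which therefore accepts the residual of `s` (`acceptsFrom_eq_leftQuotient`). Every residual is a
union of languages of states, so these languages are exactly the prime residuals, and sending a
state to its language is the isomorphism. -/

namespace NominalLearning

/-! ### Orbit-finite sets and finite supports -/

/-- A set that meets only finitely many orbits. -/
def OrbitFiniteSet (G : Type*) {X : Type*} [Group G] [MulAction G X] (Z : Set X) : Prop :=
  ∃ F : Set X, F.Finite ∧ ∀ x ∈ Z, ∃ f ∈ F, ∃ g : G, x = g • f

/-- A set that is closed under the group action. -/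
def InvariantSet (G : Type*) {X : Type*} [Group G] [MulAction G X] (Z : Set X) : Prop :=
  ∀ (g : G), ∀ x ∈ Z, g • x ∈ Z

/-- The number of orbits that meet a set (zero if there are infinitely many). -/
noncomputable def orbitCount (G : Type*) {X : Type*} [Group G] [MulAction G X] (Z : Set X) : ℕ :=
  (Quotient.mk (MulAction.orbitRel G X) '' Z).ncard

section OrbitFinite

variable {G X Y : Type*} [Group G] [MulAction G X] [MulAction G Y]

theorem OrbitFiniteSet.mono {Z W : Set X} (hW : OrbitFiniteSet G W) (h : Z ⊆ W) :
    OrbitFiniteSet G Z := by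
  obtain ⟨F, hF, hFW⟩ := hW
  exact ⟨F, hF, fun x hx => hFW x (h hx)⟩

theorem OrbitFiniteSet.union {Z W : Set X} (hZ : OrbitFiniteSet G Z) (hW : OrbitFiniteSet G W) :
    OrbitFiniteSet G (Z ∪ W) := by
  obtain ⟨F, hF, hFZ⟩ := hZ
  obtain ⟨F', hF', hFW⟩ := hW
  refine ⟨F ∪ F', hF.union hF', ?_⟩
  rintro x (hx | hx)
  · obtain ⟨f, hf, h⟩ := hFZ x hx
    exact ⟨f, Or.inl hf, h⟩
  · obtain ⟨f, hf, h⟩ := hFW x hx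
    exact ⟨f, Or.inr hf, h⟩

theorem OrbitFiniteSet.image {Z : Set X} (hZ : OrbitFiniteSet G Z) (f : X → Y)
    (hf : ∀ (g : G) (x : X), f (g • x) = g • f x) : OrbitFiniteSet G (f '' Z) := by
  obtain ⟨F, hF, hFZ⟩ := hZ
  refine ⟨f '' F, hF.image f, ?_⟩
  rintro _ ⟨x, hx, rfl⟩
  obtain ⟨y, hy, g, rfl⟩ := hFZ x hx
  exact ⟨f y, ⟨y, hy, rfl⟩, g, hf g y⟩

theorem OrbitFiniteSet.finite_orbits {Z : Set X} (hZ : OrbitFiniteSet G Z) :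
    (Quotient.mk (MulAction.orbitRel G X) '' Z).Finite := by
  obtain ⟨F, hF, hFZ⟩ := hZ
  refine (hF.image (Quotient.mk (MulAction.orbitRel G X))).subset ?_
  rintro _ ⟨x, hx, rfl⟩
  obtain ⟨f, hf, g, rfl⟩ := hFZ x hx
  exact ⟨f, hf, Quotient.sound (MulAction.orbitRel_apply.2 ⟨g⁻¹, inv_smul_smul g f⟩)⟩

theorem orbitFiniteSet_univ [Finite (MulAction.orbitRel.Quotient G X)] :
    OrbitFiniteSet G (Set.univ : Set X) := by
  refine ⟨Set.range (fun q : MulAction.orbitRel.Quotient G X => q.out), Set.finite_range _, ?_⟩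
  intro x _
  refine ⟨_, ⟨Quotient.mk (MulAction.orbitRel G X) x, rfl⟩, ?_⟩
  obtain ⟨g, hg⟩ := MulAction.orbitRel_apply.1
    (Quotient.exact (Quotient.out_eq (Quotient.mk (MulAction.orbitRel G X) x)))
  refine ⟨g⁻¹, ?_⟩
  rw [eq_inv_smul_iff]
  exact hg

theorem OrbitFiniteSet.finite_quotient {Z : SubMulAction G X}
    (hZ : OrbitFiniteSet G (Z : Set X)) : Finite (MulAction.orbitRel.Quotient G Z) := by
  have hfin := hZ.finite_orbits.to_subtype
  let f : MulAction.orbitRel.Quotient G Z → Quotient.mk (MulAction.orbitRel G X) '' (Z : Set X) :=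
    fun q => ⟨Quotient.mk _ (q.out : X), q.out, q.out.2, rfl⟩
  refine Finite.of_injective f fun p q hpq => ?_
  obtain ⟨g, hg⟩ := MulAction.orbitRel_apply.1 (Quotient.exact (Subtype.ext_iff.1 hpq))
  rw [← Quotient.out_eq p, ← Quotient.out_eq q]
  exact Quotient.sound (MulAction.orbitRel_apply.2 ⟨g, Subtype.ext hg⟩)

/-- Invariance of `Z` makes the inequality strict: the orbit of a point of `W` outside `Z` misses
`Z` altogether. -/
theorem orbitCount_lt {Z W : Set X} (hW : OrbitFiniteSet G W) (hZ : InvariantSet G Z)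
    (h : Z ⊂ W) : orbitCount G Z < orbitCount G W := by
  refine Set.ncard_lt_ncard ?_ hW.finite_orbits
  refine ⟨Set.image_mono h.1, fun hWZ => h.2 fun x hx => ?_⟩
  obtain ⟨y, hy, hyx⟩ := hWZ ⟨x, hx, rfl⟩
  obtain ⟨g, rfl⟩ := MulAction.orbitRel_apply.1 (Quotient.exact hyx)
  simpa using hZ g⁻¹ _ hy

theorem orbitCount_le {Z W : Set X} (hW : OrbitFiniteSet G W) (h : Z ⊆ W) :
    orbitCount G Z ≤ orbitCount G W :=
  Set.ncard_le_ncard (Set.image_mono h) hW.finite_orbits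

end OrbitFinite

/-- `x` has a finite support. -/
def FinitelySupported (𝔸 : Type*) {X : Type*} [MulAction (Equiv.Perm 𝔸) X] (x : X) : Prop :=
  ∃ s : Finset 𝔸, MulAction.Supports (Equiv.Perm 𝔸) (s : Set 𝔸) x

/-! ### Finite supports, products of orbit-finite sets, well-founded orders -/

section Support

variable {𝔸 X Y : Type*} [MulAction (Equiv.Perm 𝔸) X] [MulAction (Equiv.Perm 𝔸) Y]

theorem FinitelySupported.map {x : X} (hx : FinitelySupported 𝔸 x) (f : X → Y)
    (hf : ∀ (π : Equiv.Perm 𝔸) (x : X), f (π • x) = π • f x) : FinitelySupported 𝔸 (f x) := by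
  obtain ⟨s, hs⟩ := hx
  exact ⟨s, fun π hπ => by rw [← hf, hs π hπ]⟩

theorem FinitelySupported.smul {x : X} (hx : FinitelySupported 𝔸 x) (π : Equiv.Perm 𝔸) :
    FinitelySupported 𝔸 (π • x) := by
  classical
  obtain ⟨s, hs⟩ := hx
  refine ⟨s.image π, fun σ hσ => ?_⟩
  rw [← inv_smul_eq_iff, ← mul_smul, ← mul_smul]
  refine hs _ fun c hc => ?_
  change π.symm (σ (π c)) = c
  have h : σ (π c) = π c := hσ (Finset.mem_coe.2 (Finset.mem_image_of_mem π hc))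
  rw [h, Equiv.symm_apply_apply]

theorem smul_eq_of_supports {s : Finset 𝔸} {x : X}
    (hs : MulAction.Supports (Equiv.Perm 𝔸) (s : Set 𝔸) x) {π σ : Equiv.Perm 𝔸}
    (h : ∀ c ∈ s, π c = σ c) : π • x = σ • x := by
  rw [← inv_smul_eq_iff, ← mul_smul]
  refine hs _ fun c hc => ?_
  change σ⁻¹ (π c) = c
  rw [h c hc]
  exact σ.symm_apply_apply c

/-- A finite partial injection extends to a permutation of finite order. -/
theorem exists_perm_extending (U : Finset 𝔸) (f : 𝔸 → 𝔸) (hf : Set.InjOn f U) :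
    ∃ σ : Equiv.Perm 𝔸, IsOfFinOrder σ ∧ ∀ c ∈ U, σ c = f c := by
  classical
  -- Extending `f` to a permutation of this finite set, and by the identity elsewhere, is what gives
  -- finite order.
  let V : Finset 𝔸 := U ∪ U.image f
  obtain ⟨g, hg⟩ := Set.MapsTo.exists_equiv_extend_of_card_eq (α := V) (t := V) (by simp)
    (s := {c | (c : 𝔸) ∈ U}) (f := fun c => f c)
    (fun c hc => Finset.mem_union_right _ (Finset.mem_image_of_mem f hc))
    (fun c hc d hd hcd => Subtype.ext (hf hc hd hcd))
  refine ⟨Equiv.Perm.ofSubtype g, ?_, fun c hc => ?_⟩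
  · exact MonoidHom.isOfFinOrder (Equiv.Perm.ofSubtype (p := (· ∈ V))) (isOfFinOrder_of_finite g)
  · have hcV : c ∈ V := Finset.mem_union_left _ hc
    rw [Equiv.Perm.ofSubtype_apply_of_mem g hcV]
    exact hg ⟨c, hcV⟩ hc

/-- Up to permutations that fix `s` pointwise, there are only finitely many ways for a
permutation to act on the finite set `t`. -/
theorem finite_double_cosets (s t : Finset 𝔸) :
    ∃ H : Set (Equiv.Perm 𝔸), H.Finite ∧ ∀ τ : Equiv.Perm 𝔸, ∃ ρ ∈ H, ∃ σ : Equiv.Perm 𝔸,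
      (∀ c ∈ s, σ c = c) ∧ ∀ b ∈ t, σ (ρ b) = τ b := by
  classical
  -- The pattern of `τ` records which atoms of `t` it sends into `s`, and where. There are finitely
  -- many patterns; `H` takes one permutation for each.
  let Φ : Equiv.Perm 𝔸 → Finset (𝔸 × 𝔸) := fun τ => (t ×ˢ s).filter fun p => τ p.1 = p.2
  have hmem : ∀ τ, ∀ b ∈ t, ∀ c ∈ s, (b, c) ∈ Φ τ ↔ τ b = c := by
    intro τ b hb c hc
    simp [Φ, hb, hc]
  have hΦ : (Set.range Φ).Finite := by
    refine ((t ×ˢ s).powerset.finite_toSet).subset ?_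
    rintro _ ⟨τ, rfl⟩
    simp only [Finset.coe_powerset, Set.mem_preimage, Set.mem_powerset_iff, Finset.coe_subset]
    exact Finset.filter_subset _ _
  refine ⟨Function.invFun Φ '' Set.range Φ, hΦ.image _, fun τ => ?_⟩
  refine ⟨Function.invFun Φ (Φ τ), ⟨_, ⟨τ, rfl⟩, rfl⟩, ?_⟩
  have hρ : Φ (Function.invFun Φ (Φ τ)) = Φ τ := Function.invFun_eq ⟨τ, rfl⟩
  set ρ := Function.invFun Φ (Φ τ)
  have hiff : ∀ b ∈ t, ∀ c ∈ s, ρ b = c ↔ τ b = c := by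
    intro b hb c hc
    rw [← hmem ρ b hb c hc, ← hmem τ b hb c hc, hρ]
  -- The partial map that `σ` must extend: it fixes `s` and sends `ρ b` to `τ b`. Because `ρ` and
  -- `τ` have the same pattern, the two rules agree where both apply and do not break injectivity.
  let f : 𝔸 → 𝔸 := fun c => if c ∈ s then c else τ (ρ⁻¹ c)
  have hin : ∀ c ∈ s, f c = c := fun c hc => if_pos hc
  have hout : ∀ b ∈ t, f (ρ b) = τ b := by
    intro b hb
    by_cases h : ρ b ∈ s
    · rw [hin _ h]
      exact ((hiff b hb _ h).1 rfl).symm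
    · simp [f, h]
  have hcross : ∀ c ∈ s, ∀ b ∈ t, f c = f (ρ b) → c = ρ b := by
    intro c hc b hb h
    rw [hin c hc, hout b hb] at h
    exact ((hiff b hb c hc).2 h.symm).symm
  obtain ⟨σ, -, hσ⟩ := exists_perm_extending (s ∪ t.image ρ) f (by
    intro c hc d hd hcd
    simp only [Finset.coe_union, Finset.coe_image, Set.mem_union, Finset.mem_coe,
      Set.mem_image] at hc hd
    rcases hc with hc | ⟨b, hb, rfl⟩ <;> rcases hd with hd | ⟨b', hb', rfl⟩
    · rwa [hin c hc, hin d hd] at hcd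
    · exact hcross c hc b' hb' hcd
    · exact (hcross d hd b hb hcd.symm).symm
    · rw [hout b hb, hout b' hb'] at hcd
      rw [τ.injective hcd])
  refine ⟨σ, fun c hc => ?_, fun b hb => ?_⟩
  · rw [hσ c (Finset.mem_union_left _ hc), hin c hc]
  · rw [hσ _ (Finset.mem_union_right _ (Finset.mem_image_of_mem ρ hb)), hout b hb]

/-- Orbit-finite sets of finitely supported elements are closed under products. -/
theorem OrbitFiniteSet.prod {Z : Set X} {W : Set Y} (hZ : OrbitFiniteSet (Equiv.Perm 𝔸) Z)
    (hW : OrbitFiniteSet (Equiv.Perm 𝔸) W) (hZs : ∀ x ∈ Z, FinitelySupported 𝔸 x)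
    (hWs : ∀ y ∈ W, FinitelySupported 𝔸 y) : OrbitFiniteSet (Equiv.Perm 𝔸) (Z ×ˢ W) := by
  obtain ⟨F, hF, hFZ⟩ := hZ
  obtain ⟨F', hF', hFW⟩ := hW
  choose H hH hHs using fun st : Finset 𝔸 × Finset 𝔸 => finite_double_cosets st.1 st.2
  choose! s hs using fun (x : X) (hx : FinitelySupported 𝔸 x) => hx
  choose! t ht using fun (y : Y) (hy : FinitelySupported 𝔸 y) => hy
  refine ⟨⋃ f ∈ F, ⋃ f' ∈ F', (fun ρ : Equiv.Perm 𝔸 => (f, ρ • f')) '' H (s f, t f'),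
    hF.biUnion fun f _ => hF'.biUnion fun f' _ => (hH _).image _, ?_⟩
  rintro ⟨x, y⟩ ⟨hx, hy⟩
  obtain ⟨f, hf, π, rfl⟩ := hFZ x hx
  obtain ⟨f', hf', π', rfl⟩ := hFW y hy
  have hfs : FinitelySupported 𝔸 f := by simpa using (hZs _ hx).smul π⁻¹
  have hfs' : FinitelySupported 𝔸 f' := by simpa using (hWs _ hy).smul π'⁻¹
  -- Applying `π⁻¹` turns the pair into `(f, (π⁻¹ * π') • f')`. On the support of `f'` the
  -- permutation `π⁻¹ * π'` is `σ * ρ`, and `σ` fixes `f`, so this pair is `σ • (f, ρ • f')`.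
  obtain ⟨ρ, hρ, σ, hσ, hσρ⟩ := hHs (s f, t f') (π⁻¹ * π')
  refine ⟨(f, ρ • f'), ?_, π * σ, ?_⟩
  · simp only [Set.mem_iUnion]
    exact ⟨f, hf, f', hf', ρ, hρ, rfl⟩
  · have h1 : σ • f = f := hs f hfs σ hσ
    have h2 : (σ * ρ) • f' = (π⁻¹ * π') • f' := smul_eq_of_supports (ht f' hfs') hσρ
    rw [mul_smul, mul_smul, eq_inv_smul_iff] at h2
    simp only [Prod.smul_mk, mul_smul, h1, h2]

/-- An orbit of finitely supported elements is an antichain for any invariant order. -/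
theorem FinitelySupported.not_smul_lt [Preorder X]
    (hlt : ∀ (π : Equiv.Perm 𝔸) (x y : X), x < y → π • x < π • y) {x : X}
    (hx : FinitelySupported 𝔸 x) (π : Equiv.Perm 𝔸) : ¬ π • x < x := by
  obtain ⟨s, hs⟩ := hx
  obtain ⟨σ, hσ, hσπ⟩ := exists_perm_extending s π π.injective.injOn
  rw [← smul_eq_of_supports hs hσπ]
  intro h
  obtain ⟨n, hn, hpow⟩ := isOfFinOrder_iff_pow_eq_one.1 hσ
  have key : ∀ k : ℕ, σ ^ (k + 1) • x < x := by
    intro k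
    induction k with
    | zero => simpa using h
    | succ k ih =>
      rw [pow_succ', mul_smul]
      exact (hlt σ _ _ ih).trans h
  obtain ⟨k, rfl⟩ : ∃ k, n = k + 1 := ⟨n - 1, by omega⟩
  have := key k
  rw [hpow, one_smul] at this
  exact lt_irrefl x this

/-- An invariant order is well-founded on an orbit-finite set of finitely supported elements. -/
theorem OrbitFiniteSet.wellFoundedOn_lt [Preorder X]
    (hlt : ∀ (π : Equiv.Perm 𝔸) (x y : X), x < y → π • x < π • y) {Z : Set X}
    (hZ : OrbitFiniteSet (Equiv.Perm 𝔸) Z) (hZs : ∀ x ∈ Z, FinitelySupported 𝔸 x) :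
    Z.WellFoundedOn (· < ·) := by
  rw [Set.wellFoundedOn_iff_no_descending_seq]
  intro f hf
  -- With finitely many orbits, two terms of a descending sequence share one, which `not_smul_lt`
  -- forbids.
  have hfin := hZ.finite_orbits.to_subtype
  obtain ⟨i, j, hij, heq⟩ := Finite.exists_ne_map_eq_of_infinite
    (fun n : ℕ => (⟨_, f n, hf n, rfl⟩ : Quotient.mk (MulAction.orbitRel (Equiv.Perm 𝔸) X) '' Z))
  wlog h : i < j generalizing i j
  · exact this j i hij.symm heq.symm (lt_of_le_of_ne (not_lt.1 h) hij.symm)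
  obtain ⟨π, hπ⟩ := MulAction.orbitRel_apply.1 (Quotient.exact (Subtype.ext_iff.1 heq).symm)
  refine (hZs _ (hf i)).not_smul_lt hlt π ?_
  change π • f i = f j at hπ
  rw [hπ]
  exact f.map_rel_iff.2 h

theorem OrbitFiniteNominal.of_subMulAction {Z : SubMulAction (Equiv.Perm 𝔸) X}
    (hZ : OrbitFiniteSet (Equiv.Perm 𝔸) (Z : Set X)) (hZs : ∀ x ∈ Z, FinitelySupported 𝔸 x) :
    OrbitFiniteNominal 𝔸 Z := by
  refine ⟨fun x => ?_, hZ.finite_quotient⟩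
  obtain ⟨s, hs⟩ := hZs x x.2
  exact ⟨s, fun π hπ => Subtype.ext (hs π hπ)⟩

end Support

theorem mem_sSup_language {A : Type*} {R : Set (Language A)} {x : List A} :
    x ∈ sSup R ↔ ∃ r ∈ R, x ∈ r := Set.mem_sUnion

/-! ### Residuals and their restrictions to columns -/

section Residuals

variable {𝔸 : Type u} {A : Type v} [MulAction (Equiv.Perm 𝔸) A]

theorem smul_leftQuotient {L : Language A} (hL : IsEquivariant 𝔸 L) (π : Equiv.Perm 𝔸)
    (x : List A) : π • L.leftQuotient x = L.leftQuotient (π • x) := by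
  apply Set.ext
  intro y
  change x ++ π⁻¹ • y ∈ L ↔ π • x ++ y ∈ L
  rw [← hL.smul_mem_iff π (x ++ π⁻¹ • y), smul_append, smul_inv_smul]

theorem invariantSet_residuals {L : Language A} (hL : IsEquivariant 𝔸 L) :
    InvariantSet (Equiv.Perm 𝔸) (residuals L) := by
  rintro π _ ⟨x, rfl⟩
  exact ⟨π • x, (smul_leftQuotient hL π x).symm⟩

theorem IsNominalRegular.alphabet {L : Language A} (h : IsNominalRegular.{u, v, w} 𝔸 L) :
    OrbitFiniteNominal 𝔸 A := by
  obtain ⟨Q, _, M, hM, -⟩ := h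
  exact hM.alphabet

/-- The residual of `x` is the language of the state that `x` reaches, and a state determines its
language equivariantly. The residuals thus lie in the equivariant image of an orbit-finite set. -/
theorem IsNominalRegular.orbitFiniteSet_residuals {L : Language A}
    (h : IsNominalRegular.{u, v, w} 𝔸 L) :
    OrbitFiniteSet (Equiv.Perm 𝔸) (residuals L) := by
  obtain ⟨Q, _, M, hM, rfl⟩ := h
  have heval : ∀ (π : Equiv.Perm 𝔸) (x : List A) (q : Q),
      M.evalFrom (π • q) (π • x) = π • M.evalFrom q x := by
    intro π x
    induction x with
    | nil => intro q; rfl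
    | cons a x ih =>
      intro q
      have hs : π • M.step q a = M.step (π • q) (π • a) := by
        simpa [DFA.toNFA] using hM.step π q a (M.step q a) (by simp [DFA.toNFA])
      rw [smul_cons, DFA.evalFrom_cons, DFA.evalFrom_cons, ← hs, ih]
  have hacc : ∀ (π : Equiv.Perm 𝔸) (q : Q), M.acceptsFrom (π • q) = π • M.acceptsFrom q := by
    intro π q
    apply Set.ext
    intro x
    change M.evalFrom (π • q) x ∈ M.accept ↔ M.evalFrom q (π⁻¹ • x) ∈ M.accept
    have hx := heval π (π⁻¹ • x) q
    rw [smul_inv_smul] at hx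
    rw [hx]
    exact ⟨fun h => by simpa using hM.accept π⁻¹ _ h, hM.accept π _⟩
  have := hM.states.2
  refine ((orbitFiniteSet_univ (G := Equiv.Perm 𝔸) (X := Q)).image M.acceptsFrom hacc).mono ?_
  rintro _ ⟨x, rfl⟩
  exact ⟨M.eval x, trivial, (Language.leftQuotient_accepts_apply M x).symm⟩

theorem OrbitFiniteNominal.finitelySupported_word (hA : OrbitFiniteNominal 𝔸 A) (x : List A) :
    FinitelySupported 𝔸 x := by
  classical
  induction x with
  | nil => exact ⟨∅, fun π _ => smul_nil π⟩
  | cons a x ih =>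
    obtain ⟨s, hs⟩ := hA.1 a
    obtain ⟨t, ht⟩ := ih
    refine ⟨s ∪ t, fun π hπ => ?_⟩
    rw [smul_cons, hs π fun c hc => hπ (Finset.mem_coe.2 (Finset.mem_union_left t hc)),
      ht π fun c hc => hπ (Finset.mem_coe.2 (Finset.mem_union_right s hc))]

theorem finitelySupported_residual {L : Language A} (hL : IsEquivariant 𝔸 L)
    (hA : OrbitFiniteNominal 𝔸 A) {K : Language A} (hK : K ∈ residuals L) :
    FinitelySupported 𝔸 K := by
  obtain ⟨x, rfl⟩ := hK
  exact (hA.finitelySupported_word x).map _ fun π y => (smul_leftQuotient hL π y).symm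

/-- The words of `K` that belong to `E`. -/
def colRestrict (E : SubMulAction (Equiv.Perm 𝔸) (List A)) (K : Language A) : Language A :=
  {e : List A | e ∈ E ∧ e ∈ K}

theorem colRestrict_smul (E : SubMulAction (Equiv.Perm 𝔸) (List A)) (π : Equiv.Perm 𝔸)
    (K : Language A) : colRestrict E (π • K) = π • colRestrict E K := by
  apply Set.ext
  intro e
  have he : e ∈ E ↔ π⁻¹ • e ∈ E :=
    ⟨E.smul_mem π⁻¹, fun h => by simpa using E.smul_mem π h⟩
  exact and_congr he Iff.rfl

theorem colRestrict_mono (E : SubMulAction (Equiv.Perm 𝔸) (List A)) {K K' : Language A}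
    (h : K ≤ K') : colRestrict E K ≤ colRestrict E K' :=
  fun _ he => ⟨he.1, h he.2⟩

theorem colRestrict_le_of_le {E E' : SubMulAction (Equiv.Perm 𝔸) (List A)} (hE : E ≤ E')
    {K K' : Language A} (h : colRestrict E' K ≤ colRestrict E' K') :
    colRestrict E K ≤ colRestrict E K' :=
  fun _ he => ⟨he.1, (h ⟨hE he.1, he.2⟩).2⟩

end Residuals

/-! ### Prime rows, and the words that a conjecture classifies correctly -/

namespace ObsTable

variable {𝔸 : Type u} {A : Type v} [MulAction (Equiv.Perm 𝔸) A] {L : Language A}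
  {T : ObsTable 𝔸 A}

theorem row_eq_colRestrict (L : Language A) (T : ObsTable 𝔸 A) (x : List A) :
    T.row L x = colRestrict T.E (L.leftQuotient x) := rfl

theorem row_mem_rows_of_mem {s : List A} (hs : s ∈ T.S) : T.row L s ∈ T.rows L :=
  ⟨s, Or.inl hs, rfl⟩

theorem append_mem_lower {s : List A} (hs : s ∈ T.S) (a : A) : s ++ [a] ∈ T.lower :=
  ⟨s, hs, a, rfl⟩

theorem row_mem_rows_of_lower {t : List A} (ht : t ∈ T.lower) : T.row L t ∈ T.rows L :=
  ⟨t, Or.inr ht, rfl⟩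

theorem rows_subset (L : Language A) (T : ObsTable 𝔸 A) :
    T.rows L ⊆ colRestrict T.E '' residuals L := by
  rintro _ ⟨x, -, rfl⟩
  exact ⟨_, ⟨x, rfl⟩, rfl⟩

theorem orbitFiniteSet_rows (hR : OrbitFiniteSet (Equiv.Perm 𝔸) (residuals L)) :
    OrbitFiniteSet (Equiv.Perm 𝔸) (T.rows L) :=
  (hR.image _ (colRestrict_smul T.E)).mono (T.rows_subset L)

theorem finitelySupported_rows (hL : IsEquivariant 𝔸 L) (hA : OrbitFiniteNominal 𝔸 A)
    {r : Language A} (hr : r ∈ T.rows L) : FinitelySupported 𝔸 r := by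
  obtain ⟨x, -, rfl⟩ := hr
  exact (hA.finitelySupported_word x).map _ fun π y => (smul_row hL T π y).symm

theorem invariantSet_rows (hL : IsEquivariant 𝔸 L) (T : ObsTable 𝔸 A) :
    InvariantSet (Equiv.Perm 𝔸) (T.rows L) := by
  rintro π _ ⟨x, hx | ⟨s, hs, a, rfl⟩, rfl⟩
  · exact ⟨π • x, Or.inl (T.S.smul_mem π hx), smul_row hL T π x⟩
  · exact ⟨π • (s ++ [a]), Or.inr ⟨π • s, T.S.smul_mem π hs, π • a, smul_append π s [a]⟩,
      smul_row hL T π _⟩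

/-- Every row of the table is the union of the prime rows that it contains. -/
theorem row_eq_sSup_primeRows (hL : IsEquivariant 𝔸 L) (hA : OrbitFiniteNominal 𝔸 A)
    (hR : OrbitFiniteSet (Equiv.Perm 𝔸) (residuals L)) {r : Language A} (hr : r ∈ T.rows L) :
    r = sSup {p | p ∈ T.primeRows L ∧ p ≤ r} := by
  have hwf := (orbitFiniteSet_rows (T := T) hR).wellFoundedOn_lt
    (fun π x y => (smul_language_lt_iff π x y).2) fun x hx => finitelySupported_rows hL hA hx
  refine hwf.induction hr (P := fun r => r = sSup {p | p ∈ T.primeRows L ∧ p ≤ r}) ?_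
  intro r hr ih
  by_cases hp : r ∈ T.primeRows L
  · exact le_antisymm (le_sSup ⟨hp, le_rfl⟩) (sSup_le fun p hp => hp.2)
  · have hr' : r = sSup {r' | r' ∈ T.rows L ∧ r' < r} := by
      by_contra h
      exact hp ⟨hr, h⟩
    refine le_antisymm (hr'.le.trans (sSup_le ?_)) (sSup_le fun p hp => hp.2)
    rintro r' ⟨h1, h2⟩
    rw [ih r' h1 h2]
    exact sSup_le_sSup fun p hp => ⟨hp.1, hp.2.trans h2.le⟩

/-- The table is RFSA-closed if and only if all its prime rows are rows of its top part. -/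
theorem rfsaClosed_iff (hL : IsEquivariant 𝔸 L) (hA : OrbitFiniteNominal 𝔸 A)
    (hR : OrbitFiniteSet (Equiv.Perm 𝔸) (residuals L)) :
    T.RFSAClosed L hL ↔ ∀ r ∈ T.primeRows L, r ∈ T.topPrimeRows L hL := by
  constructor
  · rintro h r hr
    obtain ⟨x, hx | hx, rfl⟩ := hr.1
    · exact ⟨hr, x, hx, rfl⟩
    -- The row is not in `PR^⊤`, so all top prime rows below it are strictly below it; closedness
    -- then writes it as a union of smaller rows, against primality.
    · by_contra hn
      refine hr.2 (le_antisymm ((h x hx).le.trans (sSup_le_sSup ?_))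
        (sSup_le fun p hp => hp.2.le))
      rintro p ⟨hp, hpx⟩
      refine ⟨hp.1.1, lt_of_le_of_ne hpx ?_⟩
      rintro rfl
      exact hn hp
  · intro h t ht
    conv_lhs => rw [row_eq_sSup_primeRows hL hA hR (row_mem_rows_of_lower ht)]
    congr 1
    ext p
    exact and_congr_left fun _ => ⟨h p, fun hp => hp.1⟩

theorem exists_mem_primeRows (hL : IsEquivariant 𝔸 L) (hA : OrbitFiniteNominal 𝔸 A)
    (hR : OrbitFiniteSet (Equiv.Perm 𝔸) (residuals L)) {x e : List A}
    (hx : T.row L x ∈ T.rows L) (he : e ∈ T.row L x) :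
    ∃ p ∈ T.primeRows L, p ≤ T.row L x ∧ e ∈ p := by
  rw [row_eq_sSup_primeRows hL hA hR hx, mem_sSup_language] at he
  obtain ⟨p, ⟨hp, hpx⟩, hep⟩ := he
  exact ⟨p, hp, hpx, hep⟩

theorem exists_row_of_not_rfsaClosed (hL : IsEquivariant 𝔸 L) (hA : OrbitFiniteNominal 𝔸 A)
    (hR : OrbitFiniteSet (Equiv.Perm 𝔸) (residuals L)) (h : ¬ T.RFSAClosed L hL) :
    ∃ s ∈ T.S, ∃ a : A, T.row L (s ++ [a]) ∈ T.primeRows L ∧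
      T.row L (s ++ [a]) ∉ T.topPrimeRows L hL := by
  rw [rfsaClosed_iff hL hA hR] at h
  push Not at h
  obtain ⟨r, hr, hn⟩ := h
  obtain ⟨x, hx | ⟨s, hs, a, rfl⟩, rfl⟩ := hr.1
  · exact absurd ⟨hr, x, hx, rfl⟩ hn
  · exact ⟨s, hs, a, hr, hn⟩

theorem exists_column_of_not_rfsaConsistent (h : ¬ T.RFSAConsistent L) :
    ∃ s₁ ∈ T.S, ∃ s₂ ∈ T.S, ∃ (a : A) (e : List A), e ∈ T.E ∧ T.row L s₁ ≤ T.row L s₂ ∧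
      s₁ ++ a :: e ∈ L ∧ s₂ ++ a :: e ∉ L := by
  unfold RFSAConsistent at h
  push Not at h
  obtain ⟨s₁, h₁, s₂, h₂, a, hle, hn⟩ := h
  obtain ⟨e, he, hn⟩ := Set.not_subset.1 hn
  have he1 : (s₁ ++ [a]) ++ e ∈ L := he.2
  have he2 : (s₂ ++ [a]) ++ e ∉ L := fun h => hn ⟨he.1, h⟩
  rw [List.append_assoc] at he1 he2
  exact ⟨s₁, h₁, s₂, h₂, a, e, he.1, hle, he1, he2⟩

/-- The conditions on tables that the learner maintains. -/
structure WellFormed (T : ObsTable 𝔸 A) : Prop where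
  nil_mem_rows : [] ∈ T.S
  nil_mem_cols : [] ∈ T.E
  prefix_closed : ∀ (s : List A) (a : A), s ++ [a] ∈ T.S → s ∈ T.S
  suffix_closed : ∀ (a : A) (e : List A), a :: e ∈ T.E → e ∈ T.E
  orbitFinite_rows : OrbitFiniteSet (Equiv.Perm 𝔸) (T.S : Set (List A))
  orbitFinite_cols : OrbitFiniteSet (Equiv.Perm 𝔸) (T.E : Set (List A))

theorem orbitFiniteNominal_topPrimeRows (hL : IsEquivariant 𝔸 L) (hA : OrbitFiniteNominal 𝔸 A)
    (hR : OrbitFiniteSet (Equiv.Perm 𝔸) (residuals L)) :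
    OrbitFiniteNominal 𝔸 (T.topPrimeRows L hL) :=
  OrbitFiniteNominal.of_subMulAction
    ((orbitFiniteSet_rows (T := T) hR).mono fun _ hr => hr.1.1)
    fun _ hr => finitelySupported_rows hL hA hr.1.1

/-- The conjecture of any table is a nominal NFA. -/
theorem isNominalNFA_conjectureNFA (hL : IsEquivariant 𝔸 L) (hA : OrbitFiniteNominal 𝔸 A)
    (hR : OrbitFiniteSet (Equiv.Perm 𝔸) (residuals L)) :
    IsNominalNFA 𝔸 (T.conjectureNFA L hL) where
  states := orbitFiniteNominal_topPrimeRows hL hA hR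
  alphabet := hA
  start := by
    intro π q hq
    change π • (q : Language A) ≤ T.row L []
    rw [← smul_nil (A := A) π, ← smul_row hL, smul_language_le_iff]
    exact hq
  accept := by
    intro π q hq
    change π⁻¹ • ([] : List A) ∈ (q : Language A)
    exact hq
  step := by
    rintro π q a q' ⟨s, hs, hqs, hq'⟩
    refine ⟨π • s, T.S.smul_mem π hs, ?_, ?_⟩
    · rw [← smul_row hL, ← hqs]
      rfl
    · change π • (q' : Language A) ≤ _
      have : π • s ++ [π • a] = π • (s ++ [a]) := (smul_append π s [a]).symm
      rw [this, ← smul_row hL, smul_language_le_iff]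
      exact hq'

/-- Let the columns `T.E` be refined to `T'.E` such that the order on rows does not change and all
prime rows for `T'.E` are rows of states of the conjecture of `T`. Then the states of this
conjecture classify the words of `T'.E` correctly. -/
theorem mem_acceptsFrom_conjectureNFA_iff (hL : IsEquivariant 𝔸 L)
    (hA : OrbitFiniteNominal 𝔸 A) (hR : OrbitFiniteSet (Equiv.Perm 𝔸) (residuals L))
    {T' : ObsTable 𝔸 A} (hS : T'.S = T.S) (hE : T.E ≤ T'.E) (hnil : [] ∈ T.E)
    (hsuff : ∀ (a : A) (e : List A), a :: e ∈ T'.E → e ∈ T'.E)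
    (hle : ∀ x y, T.row L x ≤ T.row L y → T'.row L x ≤ T'.row L y)
    (hprime : ∀ r ∈ T'.primeRows L, ∃ s ∈ T.S, r = T'.row L s ∧ T.row L s ∈ T.topPrimeRows L hL)
    {e : List A} (he : e ∈ T'.E) {s : List A} (hs : s ∈ T.S)
    (hq : T.row L s ∈ T.topPrimeRows L hL) :
    e ∈ (T.conjectureNFA L hL).acceptsFrom {⟨T.row L s, hq⟩} ↔ s ++ e ∈ L := by
  induction e generalizing s with
  | nil =>
    rw [NFA.nil_mem_acceptsFrom]
    simp only [Set.mem_singleton_iff, exists_eq_left]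
    exact ⟨fun h => h.2, fun h => ⟨hnil, h⟩⟩
  | cons a e ih =>
    have he' := hsuff a e he
    rw [NFA.cons_mem_acceptsFrom, NFA.stepSet_singleton, NFA.mem_acceptsFrom]
    constructor
    · rintro ⟨f, hf, hfe⟩
      obtain ⟨p, ⟨s₂, hs₂, hqs, hps⟩, hpe⟩ := NFA.mem_evalFrom_iff_exists.1 hfe
      obtain ⟨p, hp⟩ := p
      obtain ⟨s', hs', rfl⟩ := hp.2
      have h1 : s' ++ e ∈ L := (ih he' hs' hp).1 ⟨f, hf, hpe⟩
      -- The transition compares rows only on `T.E`, where `e` need not be a column; `hle` carries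
      -- the inclusion over to `T'.E`. The same device replaces `s₂` by `s` below.
      have h2 : e ∈ T'.row L (s₂ ++ [a]) := hle _ _ hps ⟨he', h1⟩
      have h3 : s₂ ++ [a] ++ e ∈ L := h2.2
      rw [List.append_assoc] at h3
      exact (hle _ _ hqs.ge ⟨he, h3⟩ : a :: e ∈ T'.row L s).2
    · intro h
      have h1 : e ∈ T'.row L (s ++ [a]) := by
        refine ⟨he', ?_⟩
        rw [List.append_assoc]
        exact h
      -- The successor is chosen among the prime rows of `T'`, where the column `e` is visible;
      -- `hprime` makes it a state of the conjecture of `T`.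
      have hlow : s ++ [a] ∈ T'.lower := append_mem_lower (hS ▸ hs) a
      obtain ⟨p, hp, hps, hep⟩ :=
        exists_mem_primeRows hL hA hR (row_mem_rows_of_lower hlow) h1
      obtain ⟨s', hs', rfl, hq'⟩ := hprime p hp
      obtain ⟨f, hf, hfe⟩ := (ih he' hs' hq').2 hep.2
      exact ⟨f, hf, NFA.mem_evalFrom_iff_exists.2
        ⟨_, ⟨s, hs, rfl, colRestrict_le_of_le hE hps⟩, hfe⟩⟩

/-- The argument for a transition, applied to the initial states: `row(ε)` need not be prime, but it
is the union of the prime rows below it. -/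
theorem mem_accepts_conjectureNFA_iff (hL : IsEquivariant 𝔸 L)
    (hA : OrbitFiniteNominal 𝔸 A) (hR : OrbitFiniteSet (Equiv.Perm 𝔸) (residuals L))
    {T' : ObsTable 𝔸 A} (hT : T.WellFormed) (hS : T'.S = T.S) (hE : T.E ≤ T'.E)
    (hsuff : ∀ (a : A) (e : List A), a :: e ∈ T'.E → e ∈ T'.E)
    (hle : ∀ x y, T.row L x ≤ T.row L y → T'.row L x ≤ T'.row L y)
    (hprime : ∀ r ∈ T'.primeRows L, ∃ s ∈ T.S, r = T'.row L s ∧ T.row L s ∈ T.topPrimeRows L hL)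
    {e : List A} (he : e ∈ T'.E) :
    e ∈ (T.conjectureNFA L hL).accepts ↔ e ∈ L := by
  have key := fun {s : List A} =>
    mem_acceptsFrom_conjectureNFA_iff hL hA hR hS hE hT.nil_mem_cols hsuff hle hprime he (s := s)
  rw [NFA.mem_accepts]
  constructor
  · rintro ⟨f, hf, hfe⟩
    obtain ⟨⟨q, hq⟩, hqs, hqe⟩ := NFA.mem_evalFrom_iff_exists.1 hfe
    obtain ⟨s, hs, rfl⟩ := hq.2
    exact (hle _ _ hqs ⟨he, (key hs hq).1 ⟨f, hf, hqe⟩⟩ : e ∈ T'.row L []).2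
  · intro h
    obtain ⟨p, hp, hps, hep⟩ := exists_mem_primeRows hL hA hR
      (row_mem_rows_of_mem (T := T') (hS ▸ hT.nil_mem_rows)) (⟨he, h⟩ : e ∈ T'.row L [])
    obtain ⟨s, hs, rfl, hq⟩ := hprime p hp
    obtain ⟨f, hf, hfe⟩ := (key hs hq).2 hep.2
    exact ⟨f, hf, NFA.mem_evalFrom_iff_exists.2 ⟨_, colRestrict_le_of_le hE hps, hfe⟩⟩

end ObsTable

section Learner

variable {𝔸 : Type u} {A : Type v} [MulAction (Equiv.Perm 𝔸) A] {L : Language A}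

/-! ### Termination -/

/-- The order on residuals that the columns `E` induce. -/
def residualOrder (L : Language A) (E : SubMulAction (Equiv.Perm 𝔸) (List A)) :
    Set (Language A × Language A) :=
  {p | p ∈ residuals L ×ˢ residuals L ∧ colRestrict E p.1 ≤ colRestrict E p.2}

theorem invariantSet_residualOrder (hL : IsEquivariant 𝔸 L)
    (E : SubMulAction (Equiv.Perm 𝔸) (List A)) :
    InvariantSet (Equiv.Perm 𝔸) (residualOrder L E) := by
  rintro π ⟨K, K'⟩ ⟨⟨hK, hK'⟩, hle⟩
  refine ⟨⟨invariantSet_residuals hL π _ hK, invariantSet_residuals hL π _ hK'⟩, ?_⟩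
  change colRestrict E (π • K) ≤ colRestrict E (π • K')
  rwa [colRestrict_smul, colRestrict_smul, smul_language_le_iff]

theorem orbitFiniteSet_residualOrder (hL : IsEquivariant 𝔸 L) (hA : OrbitFiniteNominal 𝔸 A)
    (hR : OrbitFiniteSet (Equiv.Perm 𝔸) (residuals L))
    (E : SubMulAction (Equiv.Perm 𝔸) (List A)) :
    OrbitFiniteSet (Equiv.Perm 𝔸) (residualOrder L E) :=
  (hR.prod hR (fun _ => finitelySupported_residual hL hA)
    fun _ => finitelySupported_residual hL hA).mono fun _ hp => hp.1

theorem residualOrder_anti {E E' : SubMulAction (Equiv.Perm 𝔸) (List A)} (hE : E ≤ E') :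
    residualOrder L E' ⊆ residualOrder L E :=
  fun _ hp => ⟨hp.1, colRestrict_le_of_le hE hp.2⟩

namespace ObsTable

variable {T : ObsTable 𝔸 A}

/-- The residuals of the words in `T.S`. -/
def topResiduals (L : Language A) (T : ObsTable 𝔸 A) : Set (Language A) :=
  L.leftQuotient '' T.S

/-- The residuals of the words whose rows are prime rows of the table. -/
def primeRowResiduals (L : Language A) (T : ObsTable 𝔸 A) : Set (Language A) :=
  L.leftQuotient '' {x | (x ∈ T.S ∨ x ∈ T.lower) ∧ T.row L x ∈ T.primeRows L}

theorem topResiduals_subset (L : Language A) (T : ObsTable 𝔸 A) :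
    T.topResiduals L ⊆ residuals L :=
  Set.image_subset_range _ _

theorem primeRowResiduals_subset (L : Language A) (T : ObsTable 𝔸 A) :
    T.primeRowResiduals L ⊆ residuals L :=
  Set.image_subset_range _ _

theorem invariantSet_topResiduals (hL : IsEquivariant 𝔸 L) (T : ObsTable 𝔸 A) :
    InvariantSet (Equiv.Perm 𝔸) (T.topResiduals L) := by
  rintro π _ ⟨s, hs, rfl⟩
  exact ⟨π • s, T.S.smul_mem π hs, (smul_leftQuotient hL π s).symm⟩

theorem invariantSet_primeRowResiduals (hL : IsEquivariant 𝔸 L) (T : ObsTable 𝔸 A) :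
    InvariantSet (Equiv.Perm 𝔸) (T.primeRowResiduals L) := by
  rintro π _ ⟨x, ⟨hx, hp⟩, rfl⟩
  refine ⟨π • x, ⟨?_, ?_⟩, (smul_leftQuotient hL π x).symm⟩
  · rcases hx with hx | ⟨s, hs, a, rfl⟩
    · exact Or.inl (T.S.smul_mem π hx)
    · exact Or.inr ⟨π • s, T.S.smul_mem π hs, π • a, smul_append π s [a]⟩
  · rw [← smul_row hL]
    exact hp.smul (invariantSet_rows hL T) π

/-- A prime row outside `PR^⊤` differs from the row of every word of `S`. Equal residuals have equal
rows, so the residual of `x` is new. -/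
theorem topResiduals_ssubset_of_row_notMem (hL : IsEquivariant 𝔸 L) {x : List A}
    (hp : T.row L x ∈ T.primeRows L) (hn : T.row L x ∉ T.topPrimeRows L hL) :
    T.topResiduals L ⊂
      (⟨T.S ⊔ wordOrbit 𝔸 x, T.E⟩ : ObsTable 𝔸 A).topResiduals L := by
  refine ⟨Set.image_mono fun s hs => Or.inl hs, fun h => ?_⟩
  obtain ⟨s, hs, hsx⟩ := h ⟨x, Or.inr (MulAction.mem_orbit_self x), rfl⟩
  exact hn ⟨hp, s, hs, by rw [row_eq_colRestrict, row_eq_colRestrict, hsx]⟩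

theorem residualOrder_ssubset {s₁ s₂ : List A} {e : List A}
    (hle : T.row L s₁ ≤ T.row L s₂) (h₁ : s₁ ++ e ∈ L) (h₂ : s₂ ++ e ∉ L) :
    residualOrder L (T.E ⊔ wordOrbit 𝔸 e) ⊂ residualOrder L T.E := by
  refine ⟨residualOrder_anti le_sup_left, fun h => ?_⟩
  have hp : (L.leftQuotient s₁, L.leftQuotient s₂) ∈ residualOrder L T.E :=
    ⟨⟨⟨s₁, rfl⟩, ⟨s₂, rfl⟩⟩, hle⟩
  exact h₂ ((h hp).2 ⟨Or.inr (MulAction.mem_orbit_self e), h₁⟩).2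

/-- Comparing two rows involves only their residuals and the columns, so `x` and `y` are arbitrary
words and the sets `S`, `S'` play no role. -/
theorem row_le_of_residualOrder_subset {E E' : SubMulAction (Equiv.Perm 𝔸) (List A)}
    {S S' : SubMulAction (Equiv.Perm 𝔸) (List A)}
    (h : residualOrder L E ⊆ residualOrder L E') {x y : List A}
    (hxy : row L ⟨S, E⟩ x ≤ row L ⟨S, E⟩ y) : row L ⟨S', E'⟩ x ≤ row L ⟨S', E'⟩ y := by
  have hp : (L.leftQuotient x, L.leftQuotient y) ∈ residualOrder L E :=
    ⟨⟨⟨x, rfl⟩, ⟨y, rfl⟩⟩, hxy⟩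
  exact (h hp).2

/-- Prime rows remain prime if columns are added that do not change the order on residuals. -/
theorem primeRowResiduals_mono {S E E' : SubMulAction (Equiv.Perm 𝔸) (List A)} (hE : E ≤ E')
    (h : residualOrder L E ⊆ residualOrder L E') :
    primeRowResiduals L ⟨S, E⟩ ⊆ primeRowResiduals L ⟨S, E'⟩ := by
  rintro _ ⟨x, ⟨hx, hp⟩, rfl⟩
  refine ⟨x, ⟨hx, ⟨x, hx, rfl⟩, fun heq => hp.2 (le_antisymm ?_ (sSup_le fun p hp => hp.2.le))⟩,
    rfl⟩
  intro e he
  have he' : e ∈ row L ⟨S, E'⟩ x := ⟨hE he.1, he.2⟩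
  rw [heq, mem_sSup_language] at he'
  obtain ⟨_, ⟨⟨y, hy, rfl⟩, hlt⟩, hey⟩ := he'
  refine mem_sSup_language.2 ⟨row L ⟨S, E⟩ y, ⟨⟨y, hy, rfl⟩, ?_⟩, he.1, hey.2⟩
  -- Strictness survives the return to fewer columns: a reverse inclusion on `E` would lift to `E'`.
  exact lt_of_le_not_ge (colRestrict_le_of_le hE hlt.le)
    fun hge => hlt.not_ge (row_le_of_residualOrder_subset h hge)

theorem suffix_closed_sup_orbitSuffixes (hT : T.WellFormed) (t : List A) (a : A) (e : List A)
    (h : a :: e ∈ T.E ⊔ orbitSuffixes 𝔸 t) : e ∈ T.E ⊔ orbitSuffixes 𝔸 t := by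
  rcases h with h | ⟨x, hx, hex⟩
  · exact Or.inl (hT.suffix_closed a e h)
  · exact Or.inr ⟨x, hx, (List.suffix_cons a e).trans hex⟩

/-- A counterexample to the conjecture of an RFSA-closed table refines the order on residuals or
yields new prime rows. -/
theorem primeRowResiduals_ssubset_of_counterexample (hL : IsEquivariant 𝔸 L)
    (hA : OrbitFiniteNominal 𝔸 A) (hR : OrbitFiniteSet (Equiv.Perm 𝔸) (residuals L))
    (hT : T.WellFormed) (hc : T.RFSAClosed L hL) {t : List A}
    (ht : ¬ (t ∈ (T.conjectureNFA L hL).accepts ↔ t ∈ L))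
    (h : residualOrder L T.E ⊆ residualOrder L (T.E ⊔ orbitSuffixes 𝔸 t)) :
    T.primeRowResiduals L ⊂ primeRowResiduals L ⟨T.S, T.E ⊔ orbitSuffixes 𝔸 t⟩ := by
  have hE : T.E ≤ T.E ⊔ orbitSuffixes 𝔸 t := le_sup_left
  refine ⟨primeRowResiduals_mono hE h, fun hsub => ht ?_⟩
  refine mem_accepts_conjectureNFA_iff hL hA hR (T' := ⟨T.S, T.E ⊔ orbitSuffixes 𝔸 t⟩) hT rfl hE
    (suffix_closed_sup_orbitSuffixes hT t) (fun x y => row_le_of_residualOrder_subset h) ?_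
    (Or.inr ⟨t, MulAction.mem_orbit_self t, List.suffix_rfl⟩)
  rintro _ hr
  obtain ⟨x, hx, rfl⟩ := hr.1
  -- With no new residual, the row of `x` was already prime in `T`, so closedness yields a word of
  -- `S` with the same row; the unchanged order preserves this equality over the new columns.
  obtain ⟨y, ⟨-, hy⟩, hyx⟩ := hsub ⟨x, ⟨hx, hr⟩, rfl⟩
  have hxy : T.row L x = T.row L y := by rw [row_eq_colRestrict, row_eq_colRestrict, hyx]
  have htop : T.row L x ∈ T.topPrimeRows L hL :=
    (rfsaClosed_iff hL hA hR).1 hc _ (hxy ▸ hy)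
  obtain ⟨s, hs, hxs⟩ := htop.2
  exact ⟨s, hs, le_antisymm (row_le_of_residualOrder_subset h hxs.le)
    (row_le_of_residualOrder_subset h hxs.ge), hxs ▸ htop⟩

end ObsTable

/-! ### Invariants of runs and the decreasing measure -/

theorem orbitFiniteSet_wordOrbit (x : List A) :
    OrbitFiniteSet (Equiv.Perm 𝔸) (wordOrbit 𝔸 x : Set (List A)) := by
  refine ⟨{x}, Set.finite_singleton x, ?_⟩
  rintro _ ⟨π, rfl⟩
  exact ⟨x, rfl, π, rfl⟩

theorem orbitFiniteSet_orbitSuffixes (t : List A) :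
    OrbitFiniteSet (Equiv.Perm 𝔸) (orbitSuffixes 𝔸 t : Set (List A)) := by
  refine ⟨{y | y <:+ t}, ?_, ?_⟩
  · refine (List.finite_toSet t.tails).subset fun y hy => ?_
    exact (List.mem_tails y t).2 hy
  · rintro y ⟨_, ⟨π, rfl⟩, z, hz⟩
    refine ⟨π⁻¹ • y, ⟨π⁻¹ • z, ?_⟩, π, (smul_inv_smul π y).symm⟩
    rw [← smul_append, hz]
    exact inv_smul_smul π t

/-- The conditions that hold at all configurations that occur in a run. -/
structure Config.Valid (L : Language A) (hL : IsEquivariant 𝔸 L) (c : Config 𝔸 A) : Prop where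
  wellFormed : c.table.WellFormed
  conjecture : ∀ T, c = .conjecture T → T.RFSAClosed L hL ∧ T.RFSAConsistent L
  returned : ∀ T, c = .returned T →
    (T.RFSAClosed L hL ∧ T.RFSAConsistent L) ∧ (T.conjectureNFA L hL).accepts = L

theorem Config.valid_init (hL : IsEquivariant 𝔸 L) : (Config.init 𝔸 A).Valid L hL where
  wellFormed :=
    { nil_mem_rows := rfl
      nil_mem_cols := rfl
      prefix_closed := fun s a h => absurd h (List.append_ne_nil_of_right_ne_nil s (by simp))
      suffix_closed := fun a e h => absurd h (List.cons_ne_nil a e)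
      orbitFinite_rows := ⟨{[]}, Set.finite_singleton _, fun x hx => ⟨[], rfl, 1, hx⟩⟩
      orbitFinite_cols := ⟨{[]}, Set.finite_singleton _, fun x hx => ⟨[], rfl, 1, hx⟩⟩ }
  conjecture := fun _ h => (nomatch h)
  returned := fun _ h => (nomatch h)

theorem Config.Valid.step {hL : IsEquivariant 𝔸 L} {c c' : Config 𝔸 A} (hc : c.Valid L hL)
    (h : Step L hL c c') : c'.Valid L hL := by
  have hT := hc.wellFormed
  cases h with
  | enterLoop T h => exact ⟨hT, fun _ h => (nomatch h), fun _ h => (nomatch h)⟩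
  | exitLoop T h => exact ⟨hT, fun _ h' => (by cases h'; exact h), fun _ h => (nomatch h)⟩
  | skipClosed T h => exact ⟨hT, fun _ h => (nomatch h), fun _ h => (nomatch h)⟩
  | addRow T h s a hs hp hn =>
    refine ⟨⟨Or.inl hT.nil_mem_rows, hT.nil_mem_cols, ?_, hT.suffix_closed,
      hT.orbitFinite_rows.union (orbitFiniteSet_wordOrbit _), hT.orbitFinite_cols⟩,
      fun _ h => (nomatch h), fun _ h => (nomatch h)⟩
    rintro s' a' (h' | ⟨π, hπ⟩)
    · exact Or.inl (hT.prefix_closed s' a' h')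
    · change π • (s ++ [a]) = s' ++ [a'] at hπ
      rw [smul_append] at hπ
      rw [← (List.append_inj' hπ rfl).1]
      exact Or.inl (T.S.smul_mem π hs)
  | skipConsistent T h => exact ⟨hT, fun _ h => (nomatch h), fun _ h => (nomatch h)⟩
  | addColumn T h s₁ s₂ a e hs₁ hs₂ he hle h₁ h₂ =>
    refine ⟨⟨hT.nil_mem_rows, Or.inl hT.nil_mem_cols, hT.prefix_closed, ?_,
      hT.orbitFinite_rows, hT.orbitFinite_cols.union (orbitFiniteSet_wordOrbit _)⟩,
      fun _ h => (nomatch h), fun _ h => (nomatch h)⟩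
    rintro a' e' (h' | ⟨π, hπ⟩)
    · exact Or.inl (hT.suffix_closed a' e' h')
    · change π • a :: π • e = a' :: e' at hπ
      rw [← (List.cons.inj hπ).2]
      exact Or.inl (T.E.smul_mem π he)
  | counterexample T t ht =>
    exact ⟨⟨hT.nil_mem_rows, Or.inl hT.nil_mem_cols, hT.prefix_closed,
      ObsTable.suffix_closed_sup_orbitSuffixes hT t,
      hT.orbitFinite_rows, hT.orbitFinite_cols.union (orbitFiniteSet_orbitSuffixes t)⟩,
      fun _ h => (nomatch h), fun _ h => (nomatch h)⟩
  | accepted T h =>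
    exact ⟨hT, fun _ h => (nomatch h), fun _ h' => by cases h'; exact ⟨hc.conjecture T rfl, h⟩⟩

theorem Reachable.valid {hL : IsEquivariant 𝔸 L} {c : Config 𝔸 A} (h : Reachable L hL c) :
    c.Valid L hL := by
  induction h with
  | refl => exact Config.valid_init hL
  | tail _ hstep ih => exact ih.step hstep

open Classical in
/-- The number of steps that the learner can take without changing its table. -/
noncomputable def Config.rank (L : Language A) (hL : IsEquivariant 𝔸 L) : Config 𝔸 A → ℕ
  | .whileTest T => if T.RFSAClosed L hL ∧ T.RFSAConsistent L then 2 else 5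
  | .closedTest _ => 4
  -- A table that is not closed arrives here only from `addRow`, which lowers an earlier component
  -- of the measure. The value can then be 6, above the 5 of the loop test that may follow; a closed
  -- table descends through 4, 3, 2.
  | .consistentTest T => if T.RFSAClosed L hL then 3 else 6
  | .conjecture _ => 1
  | .returned _ => 0

/-- A measure that decreases with every step of the learner. -/
noncomputable def Config.measure (L : Language A) (hL : IsEquivariant 𝔸 L) (c : Config 𝔸 A) :
    ℕ ×ₗ ℕ ×ₗ ℕ ×ₗ ℕ :=
  toLex (orbitCount (Equiv.Perm 𝔸) (residuals L) -
      orbitCount (Equiv.Perm 𝔸) (c.table.topResiduals L),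
    toLex (orbitCount (Equiv.Perm 𝔸) (residualOrder L c.table.E),
      toLex (orbitCount (Equiv.Perm 𝔸) (residuals L) -
        orbitCount (Equiv.Perm 𝔸) (c.table.primeRowResiduals L), c.rank L hL)))

theorem Config.measure_lt_of_rank_lt {hL : IsEquivariant 𝔸 L} {c c' : Config 𝔸 A}
    (hT : c'.table = c.table) (h : c'.rank L hL < c.rank L hL) :
    c'.measure L hL < c.measure L hL := by
  simp only [Config.measure, hT, Prod.Lex.toLex_lt_toLex]
  exact Or.inr ⟨trivial, Or.inr ⟨trivial, Or.inr ⟨trivial, h⟩⟩⟩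

/-- `addRow` lowers the first component and `addColumn` the second. A counterexample lowers the
second if it refines the order on residuals, otherwise the third. The remaining steps keep the table
and lower the rank. -/
theorem Config.Valid.measure_lt {hL : IsEquivariant 𝔸 L} (hA : OrbitFiniteNominal 𝔸 A)
    (hR : OrbitFiniteSet (Equiv.Perm 𝔸) (residuals L)) {c c' : Config 𝔸 A}
    (hc : c.Valid L hL) (h : Step L hL c c') : c'.measure L hL < c.measure L hL := by
  cases h with
  | enterLoop T h => exact measure_lt_of_rank_lt rfl (by simp [rank, h])
  | exitLoop T h => exact measure_lt_of_rank_lt rfl (by simp [rank, h])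
  | skipClosed T h => exact measure_lt_of_rank_lt rfl (by simp [rank, h])
  | skipConsistent T h =>
    refine measure_lt_of_rank_lt rfl ?_
    by_cases hcl : T.RFSAClosed L hL <;> simp [rank, h, hcl]
  | accepted T h => exact measure_lt_of_rank_lt rfl (by simp [rank])
  | addRow T h s a hs hp hn =>
    simp only [measure, Prod.Lex.toLex_lt_toLex]
    left
    have h1 := orbitCount_lt (hR.mono (ObsTable.topResiduals_subset L _))
      (ObsTable.invariantSet_topResiduals hL T)
      (ObsTable.topResiduals_ssubset_of_row_notMem hL hp hn)
    have h2 := orbitCount_le hR (ObsTable.topResiduals_subset L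
      (⟨T.S ⊔ wordOrbit 𝔸 (s ++ [a]), T.E⟩ : ObsTable 𝔸 A))
    exact Nat.sub_lt_sub_left (h1.trans_le h2) h1
  | addColumn T h s₁ s₂ a e hs₁ hs₂ he hle h₁ h₂ =>
    simp only [measure, Prod.Lex.toLex_lt_toLex]
    refine Or.inr ⟨rfl, Or.inl ?_⟩
    exact orbitCount_lt (orbitFiniteSet_residualOrder hL hA hR T.E)
      (invariantSet_residualOrder hL _) (ObsTable.residualOrder_ssubset hle h₁ h₂)
  | counterexample T t ht =>
    simp only [measure, Prod.Lex.toLex_lt_toLex]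
    refine Or.inr ⟨rfl, ?_⟩
    have hE : T.E ≤ T.E ⊔ orbitSuffixes 𝔸 t := le_sup_left
    by_cases hsub : residualOrder L T.E ⊆ residualOrder L (T.E ⊔ orbitSuffixes 𝔸 t)
    · refine Or.inr ⟨?_, Or.inl ?_⟩
      · simp only [table, (residualOrder_anti hE).antisymm hsub]
      · have h1 := orbitCount_lt (hR.mono (ObsTable.primeRowResiduals_subset L _))
          (ObsTable.invariantSet_primeRowResiduals hL T)
          (ObsTable.primeRowResiduals_ssubset_of_counterexample hL hA hR hc.wellFormed
            (hc.conjecture T rfl).1 ht hsub)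
        have h2 := orbitCount_le hR (ObsTable.primeRowResiduals_subset L
          (⟨T.S, T.E ⊔ orbitSuffixes 𝔸 t⟩ : ObsTable 𝔸 A))
        exact Nat.sub_lt_sub_left (h1.trans_le h2) h1
    · left
      exact orbitCount_lt (orbitFiniteSet_residualOrder hL hA hR T.E)
        (invariantSet_residualOrder hL _) ⟨residualOrder_anti hE, hsub⟩

/-- The learner has no infinite run. -/
theorem not_exists_infinite_run (hL : IsEquivariant 𝔸 L) (hA : OrbitFiniteNominal 𝔸 A)
    (hR : OrbitFiniteSet (Equiv.Perm 𝔸) (residuals L)) :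
    ¬ ∃ run : ℕ → Config 𝔸 A, run 0 = Config.init 𝔸 A ∧
      ∀ n : ℕ, Step L hL (run n) (run (n + 1)) := by
  rintro ⟨run, h0, hrun⟩
  have hvalid : ∀ n, (run n).Valid L hL := by
    intro n
    induction n with
    | zero => rw [h0]; exact Config.valid_init hL
    | succ n ih => exact ih.step (hrun n)
  exact not_strictAnti_of_wellFoundedLT (fun n => (run n).measure L hL)
    (strictAnti_nat_of_succ_lt fun n => (hvalid n).measure_lt hA hR (hrun n))

/-- The learner can take a step unless it has returned. -/
theorem exists_step_or_returned (hL : IsEquivariant 𝔸 L) (hA : OrbitFiniteNominal 𝔸 A)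
    (hR : OrbitFiniteSet (Equiv.Perm 𝔸) (residuals L)) (c : Config 𝔸 A) :
    (∃ c', Step L hL c c') ∨ ∃ T, c = .returned T := by
  cases c with
  | whileTest T =>
    left
    by_cases h : T.RFSAClosed L hL ∧ T.RFSAConsistent L
    · exact ⟨_, .exitLoop T h⟩
    · exact ⟨_, .enterLoop T h⟩
  | closedTest T =>
    left
    by_cases h : T.RFSAClosed L hL
    · exact ⟨_, .skipClosed T h⟩
    · obtain ⟨s, hs, a, hp, hn⟩ := ObsTable.exists_row_of_not_rfsaClosed hL hA hR h
      exact ⟨_, .addRow T h s a hs hp hn⟩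
  | consistentTest T =>
    left
    by_cases h : T.RFSAConsistent L
    · exact ⟨_, .skipConsistent T h⟩
    · obtain ⟨s₁, h₁, s₂, h₂, a, e, he, hle, h1, h2⟩ :=
        ObsTable.exists_column_of_not_rfsaConsistent h
      exact ⟨_, .addColumn T h s₁ s₂ a e h₁ h₂ he hle h1 h2⟩
  | conjecture T =>
    left
    by_cases h : (T.conjectureNFA L hL).accepts = L
    · exact ⟨_, .accepted T h⟩
    · have : ¬ ∀ t, t ∈ (T.conjectureNFA L hL).accepts ↔ t ∈ L := fun h' => h (Set.ext h')
      push Not at this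
      obtain ⟨t, ht⟩ := this
      exact ⟨_, .counterexample T t (by tauto)⟩
  | returned T => exact Or.inr ⟨T, rfl⟩

/-! ### The returned automaton -/

theorem leftQuotient_accepts_nfa {Q : Type*} (M : NFA A Q) (x : List A) :
    M.accepts.leftQuotient x = M.acceptsFrom (M.eval x) := by
  apply Set.ext
  intro y
  exact NFA.append_mem_acceptsFrom M

theorem mem_acceptsFrom_iff_exists {Q : Type*} (M : NFA A Q) {S : Set Q} {x : List A} :
    x ∈ M.acceptsFrom S ↔ ∃ q ∈ S, x ∈ M.acceptsFrom {q} := by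
  simp only [NFA.mem_acceptsFrom]
  constructor
  · rintro ⟨f, hf, hfx⟩
    obtain ⟨q, hq, h⟩ := NFA.mem_evalFrom_iff_exists.1 hfx
    exact ⟨q, hq, f, hf, h⟩
  · rintro ⟨q, hq, f, hf, h⟩
    exact ⟨f, hf, NFA.mem_evalFrom_iff_exists.2 ⟨q, hq, h⟩⟩

namespace ObsTable

variable {T : ObsTable 𝔸 A}

/-- In an RFSA-closed table, a state of the conjecture accepts a column if and only if its row
contains it. -/
theorem colRestrict_acceptsFrom (hL : IsEquivariant 𝔸 L) (hA : OrbitFiniteNominal 𝔸 A)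
    (hR : OrbitFiniteSet (Equiv.Perm 𝔸) (residuals L)) (hT : T.WellFormed)
    (hc : T.RFSAClosed L hL) (q : T.topPrimeRows L hL) :
    colRestrict T.E ((T.conjectureNFA L hL).acceptsFrom {q}) = q := by
  obtain ⟨q, hq⟩ := q
  obtain ⟨s, hs, rfl⟩ := hq.2
  apply Set.ext
  intro e
  refine and_congr_right fun he => ?_
  refine mem_acceptsFrom_conjectureNFA_iff hL hA hR (T' := T) rfl le_rfl hT.nil_mem_cols
    hT.suffix_closed (fun _ _ h => h) ?_ he hs hq
  intro r hr
  have hr' := (rfsaClosed_iff hL hA hR).1 hc r hr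
  obtain ⟨s', hs', rfl⟩ := hr'.2
  exact ⟨s', hs', rfl, hr'⟩

/-- In an RFSA-consistent table, smaller rows accept smaller languages. -/
theorem acceptsFrom_mono (hL : IsEquivariant 𝔸 L) (hcons : T.RFSAConsistent L)
    {q q' : T.topPrimeRows L hL} (h : (q : Language A) ≤ q') :
    (T.conjectureNFA L hL).acceptsFrom {q} ≤ (T.conjectureNFA L hL).acceptsFrom {q'} := by
  intro x hx
  cases x with
  | nil =>
    obtain ⟨p, hp, hpa⟩ := (NFA.nil_mem_acceptsFrom _).1 hx
    obtain rfl : p = q := hp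
    exact (NFA.nil_mem_acceptsFrom _).2 ⟨q', rfl, h hpa⟩
  | cons a x =>
    have hx' := (NFA.cons_mem_acceptsFrom _).1 hx
    rw [NFA.stepSet_singleton] at hx'
    obtain ⟨p, ⟨s, hs, hqs, hps⟩, hpx⟩ := (mem_acceptsFrom_iff_exists _).1 hx'
    refine (NFA.cons_mem_acceptsFrom _).2 ?_
    rw [NFA.stepSet_singleton]
    obtain ⟨s', hs', hqs'⟩ := q'.2.2
    refine (mem_acceptsFrom_iff_exists _).2 ⟨p, ⟨s', hs', hqs', hps.trans ?_⟩, hpx⟩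
    exact hcons s hs s' hs' a (by rw [← hqs, ← hqs']; exact h)

/-- In an RFSA-consistent table, the states that a word of `T.S` reaches are contained in the row
of this word. -/
theorem le_row_of_mem_eval (hL : IsEquivariant 𝔸 L) (hT : T.WellFormed)
    (hcons : T.RFSAConsistent L) {s : List A} (hs : s ∈ T.S) {q : T.topPrimeRows L hL}
    (hq : q ∈ (T.conjectureNFA L hL).eval s) : (q : Language A) ≤ T.row L s := by
  induction s using List.reverseRecOn generalizing q with
  | nil => exact hq
  | append_singleton s a ih =>
    rw [NFA.eval_append_singleton, NFA.mem_stepSet] at hq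
    obtain ⟨p, hp, s', hs', hps', hqs'⟩ := hq
    have hs0 := hT.prefix_closed s a hs
    -- The transition into `q` uses some `s'` whose row is `p`, not necessarily `s`; consistency
    -- passes from `s'` to `s`.
    exact hqs'.trans (hcons s' hs' s hs0 a (hps' ▸ ih hs0 hp))

theorem acceptsFrom_le_acceptsFrom_iff (hL : IsEquivariant 𝔸 L) (hA : OrbitFiniteNominal 𝔸 A)
    (hR : OrbitFiniteSet (Equiv.Perm 𝔸) (residuals L)) (hT : T.WellFormed)
    (hc : T.RFSAClosed L hL) (hcons : T.RFSAConsistent L) {q q' : T.topPrimeRows L hL} :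
    (T.conjectureNFA L hL).acceptsFrom {q} ≤ (T.conjectureNFA L hL).acceptsFrom {q'} ↔
      (q : Language A) ≤ q' := by
  refine ⟨fun h => ?_, acceptsFrom_mono hL hcons⟩
  rw [← colRestrict_acceptsFrom hL hA hR hT hc q, ← colRestrict_acceptsFrom hL hA hR hT hc q']
  exact colRestrict_mono T.E h

/-- If the conjecture is correct, then the state `row(s)` accepts the residual of `s`. -/
theorem acceptsFrom_eq_leftQuotient (hL : IsEquivariant 𝔸 L) (hA : OrbitFiniteNominal 𝔸 A)
    (hR : OrbitFiniteSet (Equiv.Perm 𝔸) (residuals L)) (hT : T.WellFormed)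
    (hc : T.RFSAClosed L hL) (hcons : T.RFSAConsistent L)
    (hacc : (T.conjectureNFA L hL).accepts = L) {s : List A} (hs : s ∈ T.S)
    {q : T.topPrimeRows L hL} (hq : (q : Language A) = T.row L s) :
    (T.conjectureNFA L hL).acceptsFrom {q} = L.leftQuotient s := by
  have hquot : L.leftQuotient s =
      (T.conjectureNFA L hL).acceptsFrom ((T.conjectureNFA L hL).eval s) := by
    rw [← leftQuotient_accepts_nfa, hacc]
  have hle : ∀ p ∈ (T.conjectureNFA L hL).eval s, (p : Language A) ≤ q := fun p hp =>
    (le_row_of_mem_eval hL hT hcons hs hp).trans hq.ge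
  -- If `s` did not reach `q`, all states it reaches would have rows strictly below `q`. These rows
  -- cover `row(s)`, because the languages of the reached states cover the residual of `s`; this
  -- contradicts the primality of `q`.
  have hmem : q ∈ (T.conjectureNFA L hL).eval s := by
    by_contra hn
    refine q.2.1.2 (le_antisymm ?_ (sSup_le fun p hp => hp.2.le))
    intro e he
    rw [hq] at he
    obtain ⟨heE, hes⟩ := he
    have hes' : e ∈ L.leftQuotient s := hes
    rw [hquot] at hes'
    obtain ⟨p, hp, hpe⟩ := (mem_acceptsFrom_iff_exists _).1 hes'
    refine mem_sSup_language.2 ⟨p, ⟨p.2.1.1, lt_of_le_of_ne (hle p hp) fun h => ?_⟩, ?_⟩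
    · exact hn (Subtype.ext h ▸ hp)
    · rw [← colRestrict_acceptsFrom hL hA hR hT hc p]
      exact ⟨heE, hpe⟩
  rw [hquot]
  apply le_antisymm
  · intro x hx
    exact (mem_acceptsFrom_iff_exists _).2 ⟨q, hmem, hx⟩
  · intro x hx
    obtain ⟨p, hp, hpx⟩ := (mem_acceptsFrom_iff_exists _).1 hx
    exact acceptsFrom_mono hL hcons (hle p hp) hpx

/-- The residual of `y` is the union of the languages of the states that `y` reaches. -/
theorem exists_acceptsFrom_le_leftQuotient (hL : IsEquivariant 𝔸 L)
    (hacc : (T.conjectureNFA L hL).accepts = L) {K : Language A} (hK : K ∈ residuals L)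
    {x : List A} (hx : x ∈ K) : ∃ q : T.topPrimeRows L hL,
      (T.conjectureNFA L hL).acceptsFrom {q} ≤ K ∧ x ∈ (T.conjectureNFA L hL).acceptsFrom {q} := by
  obtain ⟨y, rfl⟩ := hK
  have hquot : L.leftQuotient y =
      (T.conjectureNFA L hL).acceptsFrom ((T.conjectureNFA L hL).eval y) := by
    rw [← leftQuotient_accepts_nfa, hacc]
  rw [hquot] at hx ⊢
  obtain ⟨q, hq, hqx⟩ := (mem_acceptsFrom_iff_exists _).1 hx
  exact ⟨q, fun z hz => (mem_acceptsFrom_iff_exists _).2 ⟨q, hq, hz⟩, hqx⟩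

theorem acceptsFrom_mem_residuals (hL : IsEquivariant 𝔸 L) (hA : OrbitFiniteNominal 𝔸 A)
    (hR : OrbitFiniteSet (Equiv.Perm 𝔸) (residuals L)) (hT : T.WellFormed)
    (hc : T.RFSAClosed L hL) (hcons : T.RFSAConsistent L)
    (hacc : (T.conjectureNFA L hL).accepts = L) (q : T.topPrimeRows L hL) :
    (T.conjectureNFA L hL).acceptsFrom {q} ∈ residuals L := by
  obtain ⟨s, hs, hq⟩ := q.2.2
  exact ⟨s, (acceptsFrom_eq_leftQuotient hL hA hR hT hc hcons hacc hs hq).symm⟩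

/-- If the language of `q` were a union of smaller residuals, it would be a union of smaller
languages of states. Their rows are strictly below `q`, and restriction to `E` would make `q` the
union of these rows. -/
theorem acceptsFrom_mem_primeResiduals (hL : IsEquivariant 𝔸 L) (hA : OrbitFiniteNominal 𝔸 A)
    (hR : OrbitFiniteSet (Equiv.Perm 𝔸) (residuals L)) (hT : T.WellFormed)
    (hc : T.RFSAClosed L hL) (hcons : T.RFSAConsistent L)
    (hacc : (T.conjectureNFA L hL).accepts = L) (q : T.topPrimeRows L hL) :
    (T.conjectureNFA L hL).acceptsFrom {q} ∈ primeResiduals L hL := by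
  refine ⟨acceptsFrom_mem_residuals hL hA hR hT hc hcons hacc q, fun h => ?_⟩
  refine q.2.1.2 (le_antisymm ?_ (sSup_le fun p hp => hp.2.le))
  intro e he
  rw [← colRestrict_acceptsFrom hL hA hR hT hc q] at he
  obtain ⟨heE, heq⟩ := he
  rw [h] at heq
  obtain ⟨K, ⟨hK, hKq⟩, heK⟩ := mem_sSup_language.1 heq
  obtain ⟨p, hpK, hep⟩ := exists_acceptsFrom_le_leftQuotient hL hacc hK heK
  have hpq := hpK.trans_lt hKq
  rw [lt_iff_le_not_ge, acceptsFrom_le_acceptsFrom_iff hL hA hR hT hc hcons,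
    acceptsFrom_le_acceptsFrom_iff hL hA hR hT hc hcons, ← lt_iff_le_not_ge] at hpq
  refine mem_sSup_language.2 ⟨p, ⟨p.2.1.1, hpq⟩, ?_⟩
  rw [← colRestrict_acceptsFrom hL hA hR hT hc p]
  exact ⟨heE, hep⟩

/-- `K` is a union of languages of states, each of which is a residual; primality forces one of them
to be `K` itself. -/
theorem exists_acceptsFrom_eq_of_mem_primeResiduals (hL : IsEquivariant 𝔸 L)
    (hA : OrbitFiniteNominal 𝔸 A) (hR : OrbitFiniteSet (Equiv.Perm 𝔸) (residuals L))
    (hT : T.WellFormed) (hc : T.RFSAClosed L hL) (hcons : T.RFSAConsistent L)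
    (hacc : (T.conjectureNFA L hL).accepts = L) {K : Language A} (hK : K ∈ primeResiduals L hL) :
    ∃ q : T.topPrimeRows L hL, (T.conjectureNFA L hL).acceptsFrom {q} = K := by
  by_contra! hn
  refine hK.2 (le_antisymm ?_ (sSup_le fun p hp => hp.2.le))
  intro x hx
  obtain ⟨q, hqK, hqx⟩ := exists_acceptsFrom_le_leftQuotient hL hacc hK.1 hx
  exact mem_sSup_language.2 ⟨_, ⟨acceptsFrom_mem_residuals hL hA hR hT hc hcons hacc q,
    lt_of_le_of_ne hqK (hn q)⟩, hqx⟩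

theorem isNominalRFSA_conjectureNFA (hL : IsEquivariant 𝔸 L) (hA : OrbitFiniteNominal 𝔸 A)
    (hR : OrbitFiniteSet (Equiv.Perm 𝔸) (residuals L)) (hT : T.WellFormed)
    (hc : T.RFSAClosed L hL) (hcons : T.RFSAConsistent L)
    (hacc : (T.conjectureNFA L hL).accepts = L) : IsNominalRFSA 𝔸 (T.conjectureNFA L hL) := by
  refine ⟨isNominalNFA_conjectureNFA hL hA hR, fun q => ?_⟩
  rw [hacc]
  exact acceptsFrom_mem_residuals hL hA hR hT hc hcons hacc q

/-- A correct conjecture is isomorphic to the canonical nominal RFSA: the state `q` corresponds to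
the language that it accepts. -/
theorem nonempty_iso_canonicalRFSA (hL : IsEquivariant 𝔸 L) (hA : OrbitFiniteNominal 𝔸 A)
    (hR : OrbitFiniteSet (Equiv.Perm 𝔸) (residuals L)) (hT : T.WellFormed)
    (hc : T.RFSAClosed L hL) (hcons : T.RFSAConsistent L)
    (hacc : (T.conjectureNFA L hL).accepts = L) :
    Nonempty (NominalNFAIso 𝔸 (T.conjectureNFA L hL) (canonicalRFSA L hL)) := by
  let f : T.topPrimeRows L hL → primeResiduals L hL := fun q =>
    ⟨(T.conjectureNFA L hL).acceptsFrom {q},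
      acceptsFrom_mem_primeResiduals hL hA hR hT hc hcons hacc q⟩
  have hbij : Function.Bijective f := by
    constructor
    · intro q q' h
      have h' := Subtype.ext_iff.1 h
      exact Subtype.ext (le_antisymm
        ((acceptsFrom_le_acceptsFrom_iff hL hA hR hT hc hcons).1 h'.le)
        ((acceptsFrom_le_acceptsFrom_iff hL hA hR hT hc hcons).1 h'.ge))
    · rintro ⟨K, hK⟩
      obtain ⟨q, hq⟩ :=
        exists_acceptsFrom_eq_of_mem_primeResiduals hL hA hR hT hc hcons hacc hK
      exact ⟨q, Subtype.ext hq⟩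
  have hrestrict := colRestrict_acceptsFrom hL hA hR hT hc
  refine ⟨{ Equiv.ofBijective f hbij with
    map_smul := ?_, start_iff := ?_, accept_iff := ?_, step_iff := ?_ }⟩
  · intro π q
    obtain ⟨s, hs, hq⟩ := q.2.2
    refine Subtype.ext ?_
    change (T.conjectureNFA L hL).acceptsFrom {π • q} =
      π • (T.conjectureNFA L hL).acceptsFrom {q}
    have hπq : ((π • q : T.topPrimeRows L hL) : Language A) = T.row L (π • s) := by
      rw [← smul_row hL, ← hq]
      rfl
    rw [acceptsFrom_eq_leftQuotient hL hA hR hT hc hcons hacc hs hq, smul_leftQuotient hL,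
      acceptsFrom_eq_leftQuotient hL hA hR hT hc hcons hacc (T.S.smul_mem π hs) hπq]
  · intro q
    change (T.conjectureNFA L hL).acceptsFrom {q} ≤ L ↔ (q : Language A) ≤ T.row L []
    constructor
    · intro h
      rw [← hrestrict q]
      exact colRestrict_mono T.E h
    · intro h x hx
      rw [← hacc]
      exact (mem_acceptsFrom_iff_exists _).2 ⟨q, h, hx⟩
  · intro q
    change [] ∈ (T.conjectureNFA L hL).acceptsFrom {q} ↔ _
    simp only [NFA.nil_mem_acceptsFrom, Set.mem_singleton_iff, exists_eq_left]
  · intro q a q'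
    change (T.conjectureNFA L hL).acceptsFrom {q'} ≤
      ((T.conjectureNFA L hL).acceptsFrom {q}).leftQuotient [a] ↔ _
    constructor
    · intro h
      obtain ⟨s, hs, hq⟩ := q.2.2
      refine ⟨s, hs, hq, ?_⟩
      -- The quotient by `[a]` of the residual of `s` is the residual of `s ++ [a]`; restricting the
      -- inclusion to `E` turns it into one between rows.
      rw [acceptsFrom_eq_leftQuotient hL hA hR hT hc hcons hacc hs hq,
        ← Language.leftQuotient_append] at h
      rw [← hrestrict q']
      exact colRestrict_mono T.E h
    · intro h x hx
      refine (NFA.cons_mem_acceptsFrom _).2 ?_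
      rw [NFA.stepSet_singleton]
      exact (mem_acceptsFrom_iff_exists _).2 ⟨q', h, hx⟩

end ObsTable

end Learner

end NominalLearning

theorem mainTheorem2 {𝔸 : Type u} [Countable 𝔸] [Infinite 𝔸] {A : Type v}
    [MulAction (Equiv.Perm 𝔸) A] (L : Language A)
    (hreg : NominalLearning.IsNominalRegular.{u, v, w} 𝔸 L) :
    -- there is no infinite run
    (¬ ∃ run : ℕ → NominalLearning.Config 𝔸 A,
      run 0 = NominalLearning.Config.init 𝔸 A ∧
      ∀ n : ℕ, NominalLearning.Step L hreg.isEquivariant (run n) (run (n + 1))) ∧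
    -- a run never gets stuck before it returns, its tables are orbit-finite,
    -- and its conjectures are nominal NFAs
    (∀ c : NominalLearning.Config 𝔸 A, NominalLearning.Reachable L hreg.isEquivariant c →
      ((∃ c', NominalLearning.Step L hreg.isEquivariant c c') ∨ ∃ T, c = .returned T) ∧
      NominalLearning.OrbitFiniteNominal 𝔸 c.table.S ∧
      NominalLearning.OrbitFiniteNominal 𝔸 c.table.E ∧
      NominalLearning.IsNominalNFA 𝔸 (c.table.conjectureNFA L hreg.isEquivariant)) ∧
    -- the automaton that is returned is the canonical nominal RFSA of `L`
    (∀ T : NominalLearning.ObsTable 𝔸 A,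
      NominalLearning.Reachable L hreg.isEquivariant (.returned T) →
      NominalLearning.IsNominalRFSA 𝔸 (T.conjectureNFA L hreg.isEquivariant) ∧
      (T.conjectureNFA L hreg.isEquivariant).accepts = L ∧
      Nonempty (NominalLearning.NominalNFAIso 𝔸 (T.conjectureNFA L hreg.isEquivariant)
        (NominalLearning.canonicalRFSA L hreg.isEquivariant))) := by
  have hA := hreg.alphabet
  have hR := hreg.orbitFiniteSet_residuals
  refine ⟨NominalLearning.not_exists_infinite_run _ hA hR, fun c hc => ?_, fun T hT => ?_⟩
  · have hT := hc.valid.wellFormed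
    exact ⟨NominalLearning.exists_step_or_returned _ hA hR c,
      .of_subMulAction hT.orbitFinite_rows fun x _ => hA.finitelySupported_word x,
      .of_subMulAction hT.orbitFinite_cols fun x _ => hA.finitelySupported_word x,
      NominalLearning.ObsTable.isNominalNFA_conjectureNFA _ hA hR⟩
  · obtain ⟨⟨hc, hcons⟩, hacc⟩ := hT.valid.returned T rfl
    have hwf := hT.valid.wellFormed
    exact ⟨NominalLearning.ObsTable.isNominalRFSA_conjectureNFA _ hA hR hwf hc hcons hacc, hacc,
      NominalLearning.ObsTable.nonempty_iso_canonicalRFSA _ hA hR hwf hc hcons hacc⟩
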